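/- **Model.** In the Parallel Semi-Asymmetric Model (PSAM), threads share a small-memory and a large-memory of words. Each thread is a sequential RAM with a constant number of registers and a binary `fork` instruction: the forking thread is suspended, two children start at the next instruction with copies of its registers (and distinct identifiers), and the parent resumes when both have ended. Instructions of different threads interleave arbitrarily. Every instruction (arithmetic on words, jump, read or write of the small-memory, test-and-set, read of the large-memory, call of a user function) costs $1$, except that a write to the large-memory costs $\omega>1$. The *work* is the total cost of all executed instructions; the *depth* is the largest cost of a sequence of dependent instructions. Small-memory usage is counted in words of the shared small-memory (thread registers are not counted). **Problem (edgeMap).** The input is a finite simple undirected graph $G=(V,E)$ with $V=\{0,\dots,n-1\}$, a set $U\subseteq V$, and two user-supplied functions $C(v)$ and $F(u,v)$ with Boolean values. Each call of a user function is an atomic unit-cost operation; $F$ may modify, and both functions may read, data structures of the user, which are not part of the algorithm's memory. The graph is in the large-memory in compressed sparse row format (adjacency lists in any order), and the small-memory holds a list of the vertices in $U$, each once, in any order; all other memory contents are arbitrary. The algorithm has to apply $F$ only to pairs $(u,v)$ with $u\in U$ and $\{u,v\}\in E$, at most once to each such pair, and only after $C(v)$ has been evaluated to true; if $F$ is not applied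 to such a pair, then $C(v)$ must have been evaluated to false. It returns, as a list without repetitions in the small-memory, the set $U'$ of all $v$ for which some application $F(u,v)$ returned true. (If $C$ and $F$ do not depend on mutable data, this means that $F$ is applied exactly once to each pair of $E_a=\{(u,v): u\in U,\ \{u,v\}\in E,\ C(v)=\mathrm{true}\}$, and $U'=\{v : \exists u,\ (u,v)\in E_a,\ F(u,v)=\mathrm{true}\}$.) **Theorem.** There are a single PSAM program for edgeMap and a constant $c$ such that for all $n$, $G$, $U$, $C$, $F$ as above, all $\omega>1$ and every word length of at least $c(1+\lfloor\log_2 n\rfloor)$ bits (with $\lfloor\log_2 0\rfloor$ read as $0$), on a machine whose small-memory has $c(n+1)$ words, in every execution (that is, for every interleaving of the threads) the program terminates without an error, solves edgeMap, and has $$\text{work}\ \le\ c\Bigl(1+\sum_{u\in U}\max(1,\deg u)\Bigr),\qquad \text{depth}\ \le\ c\,(1+\lfloor\log_2 n\rfloor).$$ In particular, it uses $O(n)$ words of small-memory in the worst case, its depth is $O(\log n)$, and, when $U$ is non-empty and has no isolated vertices, its work is $O(\sum_{u\in U}\deg u)$. -/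

import Mathlib

universe u

namespace PSAM

/-! ### The Parallel Semi-Asymmetric Model

A set of threads, each one a sequential word RAM with a `fork` instruction, shares a symmetric
small-memory and an asymmetric large-memory. A program is a finite list of instructions, with
literal register names, so that every thread has a constant number of registers. -/

/-- Arithmetic on words. -/
inductive ArithOp
  | add
  | sub
  | mul
  | div
  | mod

/-- Arithmetic on words of `w` bits, modulo `2 ^ w` (division by zero gives `0`). -/
def ArithOp.eval (w : ℕ) : ArithOp → ℕ → ℕ → ℕ
  | .add, a, b => (a + b) % 2 ^ w
  | .sub, a, b => (a + (2 ^ w - b)) % 2 ^ w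
  | .mul, a, b => (a * b) % 2 ^ w
  | .div, a, b => (a / b) % 2 ^ w
  | .mod, a, b => (a % b) % 2 ^ w

/-- Instructions. Arguments are names of registers, except that `k` is a literal constant and
`target` is a position in the program. In `load`s, `store`s and `testAndSet`, the register `addr`
holds the memory address. `callC` and `callF` call the two functions supplied by the user. -/
inductive Instr
  | const (dst k : ℕ)
  | arith (op : ArithOp) (dst a b : ℕ)
  | jump (target : ℕ)
  | jumpIfLt (a b target : ℕ)
  | loadSmall (dst addr : ℕ)
  | storeSmall (addr src : ℕ)
  | testAndSet (dst addr : ℕ)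
  | loadLarge (dst addr : ℕ)
  | storeLarge (addr src : ℕ)
  | callC (dst v : ℕ)
  | callF (dst u v : ℕ)
  | fork
  | halt

abbrev Program := List Instr

/-- Parameters of the machine: the number of bits of a word, the number of words of the
small-memory, and the cost of a write to the large-memory. -/
structure Machine where
  wordBits : ℕ
  smallWords : ℕ
  writeCost : ℝ

/-- Every instruction has unit cost, except for writes to the large-memory. -/
def Instr.cost (M : Machine) : Instr → ℝ
  | .storeLarge _ _ => M.writeCost
  | _ => 1

/-- A thread: its program counter, its registers, and the cost of the most expensive sequence of
dependent instructions that ends in the current point of the thread. -/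
structure Thread where
  pc : ℕ
  reg : ℕ → ℕ
  depth : ℝ

def Thread.advance (t : Thread) (cost : ℝ) : Thread :=
  { t with pc := t.pc + 1, depth := t.depth + cost }

def Thread.goto (t : Thread) (target : ℕ) : Thread :=
  { t with pc := target }

def Thread.setReg (t : Thread) (r x : ℕ) : Thread :=
  { t with reg := Function.update t.reg r x }

/-- The tree of threads: a thread is running, or has ended, or is suspended until its two children
have ended. -/
inductive ThreadTree
  | running (t : Thread)
  | ended (t : Thread)
  | suspended (t : Thread) (left right : ThreadTree)

def ThreadTree.depth : ThreadTree → ℝ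
  | .running t => t.depth
  | .ended t => t.depth
  | .suspended _ l r => max l.depth r.depth

/-- A record of one call of a user function on vertices, with the returned Boolean. -/
inductive Call (n : ℕ)
  | condition (v : Fin n) (result : Bool)
  | apply (u v : Fin n) (result : Bool)

/-- What the threads share: the two memories, the user's data structures (a value of type `σ`,
accessible through the user functions only), and the chronological record of the calls of user
functions. The record is not visible to programs. -/
structure Shared (n : ℕ) (σ : Type u) where
  small : ℕ → ℕ
  large : ℕ → ℕ
  user : σ
  calls : List (Call n)

section Execution

variable {n : ℕ} {σ : Type u}

/-- Execution of one instruction by a running thread. Accesses outside of the small-memory and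
calls of user functions on numbers that are not vertices are errors (`none`). The children created
by `fork` start at the next instruction with copies of the registers of the parent, except that
register `0` is `1` or `2` in the children; it is `0` in the parent, which continues at the next
instruction when both children have ended. -/
def Instr.exec (M : Machine) (C : Fin n → σ → Bool) (F : Fin n → Fin n → σ → Bool × σ)
    (i : Instr) (t : Thread) (s : Shared n σ) : Option (ThreadTree × Shared n σ) :=
  let t' := t.advance (i.cost M)
  match i with
  | .const dst k => some (.running (t'.setReg dst (k % 2 ^ M.wordBits)), s)
  | .arith op dst a b =>
      some (.running (t'.setReg dst (op.eval M.wordBits (t.reg a) (t.reg b))), s)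
  | .jump target => some (.running (t'.goto target), s)
  | .jumpIfLt a b target =>
      some (.running (if t.reg a < t.reg b then t'.goto target else t'), s)
  | .loadSmall dst addr =>
      if t.reg addr < M.smallWords then
        some (.running (t'.setReg dst (s.small (t.reg addr))), s)
      else none
  | .storeSmall addr src =>
      if t.reg addr < M.smallWords then
        some (.running t', { s with small := Function.update s.small (t.reg addr) (t.reg src) })
      else none
  | .testAndSet dst addr =>
      if t.reg addr < M.smallWords then
        some (.running (t'.setReg dst (s.small (t.reg addr))),
          if s.small (t.reg addr) = 0 then
            { s with small := Function.update s.small (t.reg addr) 1 }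
          else s)
      else none
  | .loadLarge dst addr => some (.running (t'.setReg dst (s.large (t.reg addr))), s)
  | .storeLarge addr src =>
      some (.running t', { s with large := Function.update s.large (t.reg addr) (t.reg src) })
  | .callC dst v =>
      if hv : t.reg v < n then
        let b := C ⟨t.reg v, hv⟩ s.user
        some (.running (t'.setReg dst b.toNat),
          { s with calls := s.calls ++ [.condition ⟨t.reg v, hv⟩ b] })
      else none
  | .callF dst u v =>
      if h : t.reg u < n ∧ t.reg v < n then
        let r := F ⟨t.reg u, h.1⟩ ⟨t.reg v, h.2⟩ s.user
        some (.running (t'.setReg dst r.1.toNat),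
          { s with
            user := r.2
            calls := s.calls ++ [.apply ⟨t.reg u, h.1⟩ ⟨t.reg v, h.2⟩ r.1] })
      else none
  | .fork =>
      some (.suspended (t'.setReg 0 0) (.running (t'.setReg 0 1)) (.running (t'.setReg 0 2)), s)
  | .halt => some (.ended t', s)

/-- One step of the computation, with its cost: some running thread executes an instruction, or
some suspended thread whose children have ended is resumed. Which of the possible steps is taken
is not determined. -/
inductive TreeStep (M : Machine) (C : Fin n → σ → Bool) (F : Fin n → Fin n → σ → Bool × σ)
    (P : Program) : ThreadTree → Shared n σ → ℝ → ThreadTree → Shared n σ → Prop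
  | exec {t : Thread} {s : Shared n σ} {i : Instr} {T' : ThreadTree} {s' : Shared n σ} :
      P[t.pc]? = some i → i.exec M C F t s = some (T', s') →
      TreeStep M C F P (.running t) s (i.cost M) T' s'
  | left {t : Thread} {l l' r : ThreadTree} {s s' : Shared n σ} {cost : ℝ} :
      TreeStep M C F P l s cost l' s' →
      TreeStep M C F P (.suspended t l r) s cost (.suspended t l' r) s'
  | right {t : Thread} {l r r' : ThreadTree} {s s' : Shared n σ} {cost : ℝ} :
      TreeStep M C F P r s cost r' s' →
      TreeStep M C F P (.suspended t l r) s cost (.suspended t l r') s'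
  | join {t a b : Thread} {s : Shared n σ} :
      TreeStep M C F P (.suspended t (.ended a) (.ended b)) s 0
        (.running { t with depth := max a.depth b.depth }) s

/-- A configuration of the machine, with the work done so far. -/
structure Config (n : ℕ) (σ : Type u) where
  tree : ThreadTree
  shared : Shared n σ
  work : ℝ

def Step (M : Machine) (C : Fin n → σ → Bool) (F : Fin n → Fin n → σ → Bool × σ)
    (P : Program) (x y : Config n σ) : Prop :=
  ∃ cost : ℝ, TreeStep M C F P x.tree x.shared cost y.tree y.shared ∧ y.work = x.work + cost

/-- `y` occurs in some execution that starts from `x`. -/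
def Reachable (M : Machine) (C : Fin n → σ → Bool) (F : Fin n → Fin n → σ → Bool × σ)
    (P : Program) (x y : Config n σ) : Prop :=
  Relation.ReflTransGen (Step M C F P) x y

/-- The computation is finished when the root thread has ended. -/
def Config.Finished (x : Config n σ) : Prop :=
  ∃ t : Thread, x.tree = .ended t

/-- Every execution from `x` is finite, and ends without an error with the root thread ended. -/
def Terminates (M : Machine) (C : Fin n → σ → Bool) (F : Fin n → Fin n → σ → Bool × σ)
    (P : Program) (x : Config n σ) : Prop :=
  (¬ ∃ e : ℕ → Config n σ, e 0 = x ∧ ∀ i, Step M C F P (e i) (e (i + 1))) ∧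
  ∀ y, Reachable M C F P x y → y.Finished ∨ ∃ z, Step M C F P y z

end Execution

/-! ### Input and output of edgeMap -/

section EdgeMap

variable {n : ℕ} {σ : Type u}

/-- The `k` words from address `a` on list the vertices in `A`, each one once, in any order. -/
def ListedAt (mem : ℕ → ℕ) (a k : ℕ) (A : Finset (Fin n)) : Prop :=
  Set.BijOn (fun i => mem (a + i)) (Set.Iio k) (Fin.val '' (A : Set (Fin n)))

/-- Compressed sparse row format: words `0, …, n` are the offsets of the adjacency lists, which
are stored consecutively from address `n + 1` on. -/
structure IsCSR (G : SimpleGraph (Fin n)) [DecidableRel G.Adj] (mem : ℕ → ℕ) : Prop where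
  offset_zero : mem 0 = 0
  offset_succ : ∀ v : Fin n, mem (v + 1) = mem v + G.degree v
  neighbors : ∀ v : Fin n, ListedAt mem (n + 1 + mem v) (G.degree v) (G.neighborFinset v)

/-- Initial configurations: a root thread with `n` in register `1` and `|U|` in register `2`, the
graph in the large-memory, and the vertices in `U` from address `0` of the small-memory on.
The other words in the memories are arbitrary. -/
structure IsInitial (M : Machine) (G : SimpleGraph (Fin n)) [DecidableRel G.Adj]
    (U : Finset (Fin n)) (x : Config n σ) : Prop where
  tree : x.tree = .running
    { pc := 0, reg := fun r => if r = 1 then n else if r = 2 then U.card else 0, depth := 0 }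
  work : x.work = 0
  calls : x.shared.calls = []
  graph : IsCSR G x.shared.large
  subset : ListedAt x.shared.small 0 U.card U
  small_word : ∀ a, x.shared.small a < 2 ^ M.wordBits
  large_word : ∀ a, x.shared.large a < 2 ^ M.wordBits

def Call.IsApply (u v : Fin n) (c : Call n) : Prop :=
  ∃ b, c = .apply u v b

open Classical in
/-- The calls of the user functions are those of edgeMap: `F` is only applied to edges `(u, v)`
with `u ∈ U`, at most once to each, and after `C v` has been found to be true; and if it is not
applied to such an edge, then `C v` has been found to be false. -/
structure IsEdgeMapRun (G : SimpleGraph (Fin n)) (U : Finset (Fin n)) (calls : List (Call n)) :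
    Prop where
  sound : ∀ u v b, .apply u v b ∈ calls → u ∈ U ∧ G.Adj u v
  once : ∀ u v, calls.countP (fun c => decide (c.IsApply u v)) ≤ 1
  guarded : ∀ u v b before after, calls = before ++ .apply u v b :: after →
    .condition v true ∈ before
  complete : ∀ u v, u ∈ U → G.Adj u v →
    (∃ b, .apply u v b ∈ calls) ∨ .condition v false ∈ calls

/-- The configuration is a finished one in which the calls are those of edgeMap on `G` and `U`, and
in which registers `1` and `2` of the root hold the address and the length of a list, in the
small-memory, of the vertices `v` for which some application of `F` to an edge `(u, v)` returned
true. -/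
def IsEdgeMapOutput (M : Machine) (G : SimpleGraph (Fin n)) (U : Finset (Fin n))
    (x : Config n σ) : Prop :=
  IsEdgeMapRun G U x.shared.calls ∧
  ∃ (t : Thread) (U' : Finset (Fin n)), x.tree = .ended t ∧
    (∀ v, v ∈ U' ↔ ∃ u, .apply u v true ∈ x.shared.calls) ∧
    t.reg 1 + t.reg 2 ≤ M.smallWords ∧
    ListedAt x.shared.small (t.reg 1) (t.reg 2) U'

end EdgeMap

end PSAM

/-! The algorithm forks along balanced binary trees. Sums of the degrees over the list of `U` number
the `D = ∑ deg u` edges. A fork tree over `U`, with a nested fork tree over each adjacency list,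
then gives each edge its own thread, which calls `C` and possibly `F`. The depths of the nested
trees add up to `O(log n)`, and the work is linear in `|U| + D`.

The difficulty is to list `U'` without repetitions in `O(n)` words, without spending work `n` when
`D` is small. Each target of an edge gets a slot among `min D n` ones. If `D ≥ n`, the slot is the
vertex itself. Otherwise every edge writes its own number into a cell of its target; whichever write
survives, it is the number of an edge to that target, so distinct targets have distinct slots
(`IsSlot.injective`). Cells of vertices that are not targets are never used, so they need no
initialization. A successful application writes its target into the slot and then sets the flag of
the slot. Threads with the same target write the same values, so their races are harmless. Packing
the flagged slots yields `U'` (`bijOn_packed`).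

Summation happens in place. When two halves are combined, the sum of the right half is added to the
first cell of the left half, and the cell at the midpoint keeps the sum of the right half. A later
descent gets the prefix sum at the midpoint by subtracting this cell from the prefix sum at the
right end (`Sums.eval_sub`).

Interleavings are handled by a rely-guarantee logic with budgets for steps and depth. `Safe.par`
composes two threads when the guarantee of each one implies the rely of the other one.
`Run.divideAndConquer` treats the recursion once for all modes: disjoint ranges own disjoint sets,
and the environment acts only on behalf of what a range does not own. Since the program never writes
to the large-memory, each step costs at most `1`, so the step budget bounds the work
(`Safe.reachable`) and forces termination (`Safe.terminates`). -/

namespace PSAM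

/-! ### Rely-guarantee logic for fork-join threads -/

section Logic

variable {n : ℕ} {σ : Type u} (M : Machine) (C : Fin n → σ → Bool)
  (F : Fin n → Fin n → σ → Bool × σ) (P : Program)

/-- A rely-guarantee judgment: while the environment changes the shared state only as allowed by
`R`, the tree of threads makes at most `m` steps, each one of cost at most `1` and changing the
shared state as promised by `G`; its depth never exceeds `d`, it does not get stuck, and at the end
`Q` holds of the registers and the shared state. -/
def Safe (R G : Shared n σ → Shared n σ → Prop) (Q : (ℕ → ℕ) → Shared n σ → Prop) (d : ℝ) :
    ℕ → ThreadTree → Shared n σ → Prop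
  | 0, T, s => ∀ s', R s s' → T.depth ≤ d ∧ ∃ t, T = .ended t ∧ Q t.reg s'
  | m + 1, T, s => ∀ s', R s s' → T.depth ≤ d ∧ ((∃ t, T = .ended t ∧ Q t.reg s') ∨
      ((∃ c T' s'', TreeStep M C F P T s' c T' s'') ∧
        ∀ c T' s'', TreeStep M C F P T s' c T' s'' → c ≤ 1 ∧ G s' s'' ∧ Safe R G Q d m T' s''))

/-- The judgment `Safe` for a running thread that is allowed to increase its depth by `e`. -/
def Run (R G : Shared n σ → Shared n σ → Prop) (Q : (ℕ → ℕ) → Shared n σ → Prop) (m e pc : ℕ)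
    (ρ : ℕ → ℕ) (s : Shared n σ) : Prop :=
  ∀ δ d : ℝ, δ + e ≤ d → Safe M C F P R G Q d m (.running ⟨pc, ρ, δ⟩) s

variable {M C F P}
variable {R R' G G' : Shared n σ → Shared n σ → Prop} {Q Q' : (ℕ → ℕ) → Shared n σ → Prop}
variable {m m' e e' pc : ℕ} {ρ : ℕ → ℕ} {d d' : ℝ} {T : ThreadTree} {s s' : Shared n σ}

/-- The judgment opens with an environment step, into which an earlier one is absorbed by
transitivity. -/
theorem Safe.rely (hR : ∀ a b c, R a b → R b c → R a c) (h : Safe M C F P R G Q d m T s)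
    (hs : R s s') : Safe M C F P R G Q d m T s' := by
  cases m with
  | zero => exact fun s'' h' => h s'' (hR _ _ _ hs h')
  | succ m => exact fun s'' h' => h s'' (hR _ _ _ hs h')

/-- The step budget may grow because an ended tree is accepted with any number of steps left. -/
theorem Safe.mono (hR : ∀ a b, R' a b → R a b) (hG : ∀ a b, G a b → G' a b)
    (hQ : ∀ ρ s, Q ρ s → Q' ρ s) (hd : d ≤ d') (hm : m ≤ m')
    (h : Safe M C F P R G Q d m T s) : Safe M C F P R' G' Q' d' m' T s := by
  induction m' generalizing m T s with
  | zero =>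
    obtain rfl : m = 0 := by omega
    intro s' hs
    obtain ⟨h1, t, h2, h3⟩ := h s' (hR _ _ hs)
    exact ⟨h1.trans hd, t, h2, hQ _ _ h3⟩
  | succ m' ih =>
    cases m with
    | zero =>
      intro s' hs
      obtain ⟨h1, t, h2, h3⟩ := h s' (hR _ _ hs)
      exact ⟨h1.trans hd, .inl ⟨t, h2, hQ _ _ h3⟩⟩
    | succ m =>
      intro s' hs
      obtain ⟨h1, ⟨t, h2, h3⟩ | ⟨h2, h3⟩⟩ := h s' (hR _ _ hs)
      · exact ⟨h1.trans hd, .inl ⟨t, h2, hQ _ _ h3⟩⟩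
      · refine ⟨h1.trans hd, .inr ⟨h2, fun c T' s'' hst => ?_⟩⟩
        obtain ⟨h4, h5, h6⟩ := h3 c T' s'' hst
        exact ⟨h4, hG _ _ h5, ih (by omega) h6⟩

/-- The final state is related to the initial one by whatever contains the rely and the
guarantee. -/
theorem Safe.history {H : Shared n σ → Shared n σ → Prop} {s₀ : Shared n σ}
    (hH : ∀ a b c, H a b → H b c → H a c) (hR : ∀ a b, R a b → H a b)
    (hG : ∀ a b, G a b → H a b) (h : Safe M C F P R G Q d m T s) (h₀ : H s₀ s) :
    Safe M C F P R G (fun ρ s => Q ρ s ∧ H s₀ s) d m T s := by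
  induction m generalizing T s with
  | zero =>
    intro s' hs
    obtain ⟨h1, t, h2, h3⟩ := h s' hs
    exact ⟨h1, t, h2, h3, hH _ _ _ h₀ (hR _ _ hs)⟩
  | succ m ih =>
    intro s' hs
    have hs' := hH _ _ _ h₀ (hR _ _ hs)
    obtain ⟨h1, ⟨t, h2, h3⟩ | ⟨h2, h3⟩⟩ := h s' hs
    · exact ⟨h1, .inl ⟨t, h2, h3, hs'⟩⟩
    · refine ⟨h1, .inr ⟨h2, fun c T' s'' hst => ?_⟩⟩
      obtain ⟨h4, h5, h6⟩ := h3 c T' s'' hst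
      exact ⟨h4, h5, ih h6 (hH _ _ _ hs' (hG _ _ h5))⟩

/-- Parallel composition. -/
theorem Safe.par {R₁ R₂ G₁ G₂ : Shared n σ → Shared n σ → Prop} {Q₁ Q₂ : Shared n σ → Prop}
    {m₁ m₂ m₃ : ℕ} {l r : ThreadTree} {t : Thread}
    (hR₁ : ∀ a b c, R₁ a b → R₁ b c → R₁ a c) (hR₂ : ∀ a b c, R₂ a b → R₂ b c → R₂ a c)
    (h₁ : ∀ a b, R a b → R₁ a b) (h₂ : ∀ a b, R a b → R₂ a b)
    (h₁₂ : ∀ a b, G₁ a b → R₂ a b) (h₂₁ : ∀ a b, G₂ a b → R₁ a b)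
    (hG₁ : ∀ a b, G₁ a b → G a b) (hG₂ : ∀ a b, G₂ a b → G a b) (hG : ∀ a, G a a)
    (hR : ∀ a, R a a) (hd : d ≤ d')
    (hl : Safe M C F P R₁ G₁ (fun _ => Q₁) d m₁ l s)
    (hr : Safe M C F P R₂ G₂ (fun _ => Q₂) d m₂ r s)
    (hc : ∀ (δ : ℝ) s', δ ≤ d → Q₁ s' → Q₂ s' →
      Safe M C F P R G Q d' m₃ (.running { t with depth := δ }) s') :
    Safe M C F P R G Q d' (m₁ + m₂ + m₃ + 1) (.suspended t l r) s := by
  induction hk : m₁ + m₂ generalizing m₁ m₂ l r s with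
  | zero =>
    -- Without steps left both children have ended, so only the join is possible.
    obtain rfl : m₁ = 0 := by omega
    obtain rfl : m₂ = 0 := by omega
    rw [zero_add]
    intro s' hs
    obtain ⟨d1, a, rfl, q1⟩ := hl s' (h₁ _ _ hs)
    obtain ⟨d2, b, rfl, q2⟩ := hr s' (h₂ _ _ hs)
    refine ⟨(max_le d1 d2).trans hd, .inr ⟨⟨_, _, _, .join⟩, fun c T' s'' hst => ?_⟩⟩
    cases hst with
    | left h => cases h
    | right h => cases h
    | join => exact ⟨zero_le_one, hG _, hc _ _ (max_le d1 d2) q1 q2⟩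
  | succ k ih =>
    have e1 : k + 1 + m₃ + 1 = (k + m₃ + 1) + 1 := by omega
    rw [e1]
    intro s' hs
    have hl' := Safe.rely hR₁ hl (h₁ _ _ hs)
    have hr' := Safe.rely hR₂ hr (h₂ _ _ hs)
    -- Whatever its budget, a child has either ended or has a positive budget and can move. This
    -- avoids separate cases for which of the two budgets is zero.
    have key : ∀ {m T} {R G : Shared n σ → Shared n σ → Prop} {Q : Shared n σ → Prop},
        Safe M C F P R G (fun _ => Q) d m T s' → R s' s' → T.depth ≤ d ∧
          ((∃ t, T = .ended t ∧ Q s') ∨ ∃ m', m = m' + 1 ∧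
            ((∃ c T' s'', TreeStep M C F P T s' c T' s'') ∧ ∀ c T' s'',
              TreeStep M C F P T s' c T' s'' →
                c ≤ 1 ∧ G s' s'' ∧ Safe M C F P R G (fun _ => Q) d m' T' s'')) := by
      intro m T R G Q h hr
      cases m with
      | zero => exact ⟨(h s' hr).1, .inl (h s' hr).2⟩
      | succ m =>
        refine ⟨(h s' hr).1, ?_⟩
        rcases (h s' hr).2 with h | h
        · exact .inl h
        · exact .inr ⟨m, rfl, h⟩
    obtain ⟨d1, c1⟩ := key hl' (h₁ _ _ (hR _))
    obtain ⟨d2, c2⟩ := key hr' (h₂ _ _ (hR _))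
    refine ⟨(max_le d1 d2).trans hd, .inr ⟨?_, fun c T' s'' hst => ?_⟩⟩
    · rcases c1 with ⟨a, rfl, -⟩ | ⟨_, -, ⟨c, T', s'', h⟩, -⟩
      · rcases c2 with ⟨b, rfl, -⟩ | ⟨_, -, ⟨c, T', s'', h⟩, -⟩
        · exact ⟨_, _, _, .join⟩
        · exact ⟨_, _, _, .right h⟩
      · exact ⟨_, _, _, .left h⟩
    · cases hst with
      | left h =>
        rcases c1 with ⟨a, rfl, -⟩ | ⟨m', rfl, -, h'⟩
        · cases h
        · obtain ⟨h4, h5, h6⟩ := h' _ _ _ h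
          -- A step of one child is an environment step for its sibling.
          exact ⟨h4, hG₁ _ _ h5, ih h6 (Safe.rely hR₂ hr' (h₁₂ _ _ h5)) (by omega)⟩
      | right h =>
        rcases c2 with ⟨a, rfl, -⟩ | ⟨m', rfl, -, h'⟩
        · cases h
        · obtain ⟨h4, h5, h6⟩ := h' _ _ _ h
          exact ⟨h4, hG₂ _ _ h5, ih (Safe.rely hR₁ hl' (h₂₁ _ _ h5)) h6 (by omega)⟩
      | join =>
        rcases c1 with ⟨_, -, q1⟩ | ⟨_, -, ⟨_, _, _, h⟩, -⟩
        · rcases c2 with ⟨_, -, q2⟩ | ⟨_, -, ⟨_, _, _, h⟩, -⟩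
          · exact ⟨zero_le_one, hG _, Safe.mono (fun _ _ h => h) (fun _ _ h => h)
              (fun _ _ h => h) le_rfl (by omega) (hc _ _ (max_le d1 d2) q1 q2)⟩
          · cases h
        · cases h

/-- In a safe configuration without environment, all executions are finite and successful. -/
theorem Safe.reachable {x y : Config n σ} (hR : ∀ a, R a a)
    (h : Safe M C F P R G Q d m x.tree x.shared) (hxy : Reachable M C F P x y) :
    ∃ k, Safe M C F P R G Q d k y.tree y.shared ∧ y.work + k ≤ x.work + m := by
  induction hxy with
  | refl => exact ⟨m, h, le_rfl⟩
  | tail _ hst ih =>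
    obtain ⟨k, hk, hw⟩ := ih
    obtain ⟨c, hst, hc⟩ := hst
    cases k with
    | zero =>
      obtain ⟨t, ht, -⟩ := (hk _ (hR _)).2
      rw [ht] at hst
      cases hst
    | succ k =>
      obtain ⟨-, ⟨t, ht, -⟩ | ⟨-, h'⟩⟩ := hk _ (hR _)
      · rw [ht] at hst
        cases hst
      · obtain ⟨h4, -, h6⟩ := h' _ _ _ hst
        refine ⟨k, h6, ?_⟩
        push_cast at hw
        linarith

theorem Safe.depth_le (hR : ∀ a, R a a) (h : Safe M C F P R G Q d m T s) : T.depth ≤ d := by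
  cases m with
  | zero => exact (h s (hR s)).1
  | succ m => exact (h s (hR s)).1

theorem Safe.ended {t : Thread} (hR : ∀ a, R a a) (h : Safe M C F P R G Q d m (.ended t) s) :
    Q t.reg s := by
  cases m with
  | zero =>
    obtain ⟨-, t', h, h'⟩ := h s (hR s)
    cases h
    exact h'
  | succ m =>
    obtain ⟨-, ⟨t', h, h'⟩ | ⟨⟨_, _, _, h⟩, -⟩⟩ := h s (hR s)
    · cases h
      exact h'
    · cases h

/-- Each step uses up one unit of the budget, so no execution has more than `m` steps; and the
judgment provides a step as long as the root has not ended. -/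
theorem Safe.terminates {x : Config n σ} (hR : ∀ a, R a a)
    (h : Safe M C F P R G Q d m x.tree x.shared) : Terminates M C F P x := by
  constructor
  · rintro ⟨f, rfl, hf⟩
    have : ∀ i, ∃ k, k + i ≤ m ∧ Safe M C F P R G Q d k (f i).tree (f i).shared := by
      intro i
      induction i with
      | zero => exact ⟨m, le_rfl, h⟩
      | succ i ih =>
        obtain ⟨k, hk, hs⟩ := ih
        obtain ⟨c, hst, -⟩ := hf i
        cases k with
        | zero =>
          obtain ⟨t, ht, -⟩ := (hs _ (hR _)).2
          rw [ht] at hst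
          cases hst
        | succ k =>
          obtain ⟨-, ⟨t, ht, -⟩ | ⟨-, h'⟩⟩ := hs _ (hR _)
          · rw [ht] at hst
            cases hst
          · exact ⟨k, by omega, (h' _ _ _ hst).2.2⟩
    obtain ⟨k, hk, -⟩ := this (m + 1)
    omega
  · intro y hy
    obtain ⟨k, hk, -⟩ := Safe.reachable hR h hy
    cases k with
    | zero =>
      obtain ⟨t, ht, -⟩ := (hk _ (hR _)).2
      exact .inl ⟨t, ht⟩
    | succ k =>
      obtain ⟨-, ⟨t, ht, -⟩ | ⟨⟨c, T', s'', hst⟩, -⟩⟩ := hk _ (hR _)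
      · exact .inl ⟨t, ht⟩
      · exact .inr ⟨⟨T', s'', y.work + c⟩, c, hst, rfl⟩

theorem Run.mono (h : Run M C F P R G Q m e pc ρ s) (hR : ∀ a b, R' a b → R a b)
    (hG : ∀ a b, G a b → G' a b) (hQ : ∀ ρ s, Q ρ s → Q' ρ s) (hm : m ≤ m') (he : e ≤ e') :
    Run M C F P R' G' Q' m' e' pc ρ s := by
  intro δ d hd
  have he' : (e : ℝ) ≤ e' := by exact_mod_cast he
  exact Safe.mono hR hG hQ le_rfl hm (h δ d (by linarith))

theorem Run.weaken (h : Run M C F P R G Q m e pc ρ s) (hm : m ≤ m') (he : e ≤ e') :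
    Run M C F P R G Q m' e' pc ρ s :=
  h.mono (fun _ _ h => h) (fun _ _ h => h) (fun _ _ h => h) hm he

theorem Run.rely (hR : ∀ a b c, R a b → R b c → R a c) (h : Run M C F P R G Q m e pc ρ s)
    (hs : R s s') : Run M C F P R G Q m e pc ρ s' :=
  fun δ d hd => Safe.rely hR (h δ d hd) hs

theorem Run.history {H : Shared n σ → Shared n σ → Prop}
    (hH : ∀ a b c, H a b → H b c → H a c) (hH' : ∀ a, H a a) (hR : ∀ a b, R a b → H a b)
    (hG : ∀ a b, G a b → H a b) (h : Run M C F P R G Q m e pc ρ s) :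
    Run M C F P R G (fun ρ s' => Q ρ s' ∧ H s s') m e pc ρ s :=
  fun δ d hd => Safe.history hH hR hG (h δ d hd) (hH' s)

/-- The rely and the guarantee of a thread are closed under what may happen in several steps. -/
structure Protocol (R G : Shared n σ → Shared n σ → Prop) : Prop where
  rely_refl : ∀ a, R a a
  rely_trans : ∀ a b c, R a b → R b c → R a c
  guar_refl : ∀ a, G a a

/-- One instruction of unit cost that does not fork. -/
theorem Run.step {i : Instr} (hi : P[pc]? = some i) (hcost : i.cost M = 1)
    (h : ∀ s', R s s' → ∃ pc' ρ' s'', (∀ δ : ℝ, i.exec M C F ⟨pc, ρ, δ⟩ s' =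
      some (.running ⟨pc', ρ', δ + 1⟩, s'')) ∧ G s' s'' ∧ Run M C F P R G Q m e pc' ρ' s'') :
    Run M C F P R G Q (m + 1) (e + 1) pc ρ s := by
  intro δ d hd s' hs
  obtain ⟨pc', ρ', s'', h1, h2, h3⟩ := h s' hs
  push_cast at hd
  refine ⟨?_, .inr ⟨⟨_, _, _, .exec (t := ⟨pc, ρ, δ⟩) hi (h1 δ)⟩, ?_⟩⟩
  · change δ ≤ d
    have : (0 : ℝ) ≤ e := by positivity
    linarith
  · intro c T' s₂ hst
    cases hst with
    | exec hi' hx =>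
      obtain rfl := Option.some.inj (hi.symm.trans hi')
      obtain ⟨rfl, rfl⟩ := Prod.mk.inj (Option.some.inj ((h1 δ).symm.trans hx))
      exact ⟨hcost.le, h2, h3 _ _ (by linarith)⟩

theorem Run.halt (hi : P[pc]? = some .halt) (hE : Protocol R G)
    (h : ∀ s', R s s' → Q ρ s') : Run M C F P R G Q (m + 1) (e + 1) pc ρ s := by
  intro δ d hd s' hs
  push_cast at hd
  have he : (0 : ℝ) ≤ e := by positivity
  refine ⟨?_, .inr ⟨⟨_, _, _, .exec (t := ⟨pc, ρ, δ⟩) hi rfl⟩, ?_⟩⟩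
  · change δ ≤ d
    linarith
  · intro c T' s₂ hst
    cases hst with
    | exec hi' hx =>
      obtain rfl := Option.some.inj (hi.symm.trans hi')
      obtain ⟨rfl, rfl⟩ := Prod.mk.inj (Option.some.inj hx)
      refine ⟨le_rfl, hE.guar_refl _, ?_⟩
      refine Safe.mono (m := 0) (fun _ _ h => h) (fun _ _ h => h) (fun _ _ h => h) le_rfl
        (Nat.zero_le _) ?_
      intro s'' hs'
      refine ⟨?_, _, rfl, h _ (hE.rely_trans _ _ _ hs hs')⟩
      change δ + 1 ≤ d
      linarith

/-- The budgets of work of the children are added, whereas their budget of depth is shared. The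
constant `2` pays for the fork and the join; the join costs no depth. -/
theorem Run.fork {R₁ R₂ G₁ G₂ : Shared n σ → Shared n σ → Prop} {Q₁ Q₂ : Shared n σ → Prop}
    {m₁ m₂ m₃ e₁ e₃ : ℕ} (hi : P[pc]? = some .fork)
    (hE : Protocol R G) (hE₁ : Protocol R₁ G₁) (hE₂ : Protocol R₂ G₂)
    (h₁ : ∀ a b, R a b → R₁ a b) (h₂ : ∀ a b, R a b → R₂ a b)
    (h₁₂ : ∀ a b, G₁ a b → R₂ a b) (h₂₁ : ∀ a b, G₂ a b → R₁ a b)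
    (hG₁ : ∀ a b, G₁ a b → G a b) (hG₂ : ∀ a b, G₂ a b → G a b)
    (hl : Run M C F P R₁ G₁ (fun _ => Q₁) m₁ e₁ (pc + 1) (Function.update ρ 0 1) s)
    (hr : Run M C F P R₂ G₂ (fun _ => Q₂) m₂ e₁ (pc + 1) (Function.update ρ 0 2) s)
    (hc : ∀ s', Q₁ s' → Q₂ s' → Run M C F P R G Q m₃ e₃ (pc + 1) (Function.update ρ 0 0) s') :
    Run M C F P R G Q (m₁ + m₂ + m₃ + 2) (e₁ + e₃ + 1) pc ρ s := by
  intro δ d hd s' hs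
  push_cast at hd
  have he1 : (0 : ℝ) ≤ e₁ := by positivity
  have he3 : (0 : ℝ) ≤ e₃ := by positivity
  refine ⟨?_, .inr ⟨⟨_, _, _, .exec (t := ⟨pc, ρ, δ⟩) hi rfl⟩, ?_⟩⟩
  · change δ ≤ d
    linarith
  · intro c T' s₂ hst
    cases hst with
    | exec hi' hx =>
      obtain rfl := Option.some.inj (hi.symm.trans hi')
      obtain ⟨rfl, rfl⟩ := Prod.mk.inj (Option.some.inj hx)
      refine ⟨le_rfl, hE.guar_refl _, ?_⟩
      refine Safe.par hE₁.rely_trans hE₂.rely_trans h₁ h₂ h₁₂ h₂₁ hG₁ hG₂ hE.guar_refl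
        hE.rely_refl (d := δ + 1 + e₁) (by linarith) (hl.rely hE₁.rely_trans (h₁ _ _ hs) (δ + 1) _ le_rfl)
        (hr.rely hE₂.rely_trans (h₂ _ _ hs) (δ + 1) _ le_rfl) ?_
      intro δ' s₃ hδ hq1 hq2
      exact hc s₃ hq1 hq2 δ' d (by linarith)

/-! ### Rules for the instructions -/

theorem Run.const {dst k : ℕ} (hi : P[pc]? = some (.const dst k)) (hE : Protocol R G) (hk : k < 2 ^ M.wordBits)
    (h : Run M C F P R G Q m e (pc + 1) (Function.update ρ dst k) s) :
    Run M C F P R G Q (m + 1) (e + 1) pc ρ s :=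
  Run.step hi rfl fun s' hs => ⟨_, _, s', fun _ => by
    simp only [Instr.exec, Thread.advance, Thread.setReg, Instr.cost, Nat.mod_eq_of_lt hk],
    hE.guar_refl _, h.rely hE.rely_trans hs⟩

theorem Run.arith {op : ArithOp} {dst a b : ℕ} (x : ℕ) (hi : P[pc]? = some (.arith op dst a b))
    (hE : Protocol R G)
    (hx : op.eval M.wordBits (ρ a) (ρ b) = x)
    (h : Run M C F P R G Q m e (pc + 1) (Function.update ρ dst x) s) :
    Run M C F P R G Q (m + 1) (e + 1) pc ρ s :=
  Run.step hi rfl fun s' hs => ⟨_, _, s', fun _ => by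
    simp only [Instr.exec, Thread.advance, Thread.setReg, Instr.cost, hx], hE.guar_refl _, h.rely hE.rely_trans hs⟩

theorem Run.jump {target : ℕ} (hi : P[pc]? = some (.jump target)) (hE : Protocol R G) (h : Run M C F P R G Q m e target ρ s) :
    Run M C F P R G Q (m + 1) (e + 1) pc ρ s :=
  Run.step hi rfl fun s' hs => ⟨_, _, s', fun _ => rfl, hE.guar_refl _, h.rely hE.rely_trans hs⟩

theorem Run.jumpIfLt {a b target : ℕ} (hi : P[pc]? = some (.jumpIfLt a b target))
    (hE : Protocol R G)
    (h : Run M C F P R G Q m e (if ρ a < ρ b then target else pc + 1) ρ s) :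
    Run M C F P R G Q (m + 1) (e + 1) pc ρ s := by
  refine Run.step hi rfl fun s' hs => ⟨_, _, s', fun _ => ?_, hE.guar_refl _, h.rely hE.rely_trans hs⟩
  simp only [Instr.exec, Thread.advance, Thread.goto, Instr.cost]
  split_ifs <;> rfl

theorem Run.jumpIfLt_true {a b target : ℕ} (hi : P[pc]? = some (.jumpIfLt a b target))
    (hE : Protocol R G) (hab : ρ a < ρ b)
    (h : Run M C F P R G Q m e target ρ s) :
    Run M C F P R G Q (m + 1) (e + 1) pc ρ s :=
  Run.jumpIfLt hi hE (by rwa [if_pos hab])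

theorem Run.jumpIfLt_false {a b target : ℕ} (hi : P[pc]? = some (.jumpIfLt a b target))
    (hE : Protocol R G) (hab : ρ b ≤ ρ a)
    (h : Run M C F P R G Q m e (pc + 1) ρ s) :
    Run M C F P R G Q (m + 1) (e + 1) pc ρ s :=
  Run.jumpIfLt hi hE (by rwa [if_neg hab.not_gt])

theorem Run.loadSmall {dst addr : ℕ} (hi : P[pc]? = some (.loadSmall dst addr))
    (hE : Protocol R G) (ha : ρ addr < M.smallWords)
    (h : ∀ s', R s s' → Run M C F P R G Q m e (pc + 1)
      (Function.update ρ dst (s'.small (ρ addr))) s') :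
    Run M C F P R G Q (m + 1) (e + 1) pc ρ s :=
  Run.step hi rfl fun s' hs => ⟨_, _, s', fun _ => by
    simp only [Instr.exec, ha, if_true, Thread.advance, Thread.setReg, Instr.cost], hE.guar_refl _, h _ hs⟩

theorem Run.loadLarge {dst addr : ℕ} (hi : P[pc]? = some (.loadLarge dst addr))
    (hE : Protocol R G)
    (h : ∀ s', R s s' → Run M C F P R G Q m e (pc + 1)
      (Function.update ρ dst (s'.large (ρ addr))) s') :
    Run M C F P R G Q (m + 1) (e + 1) pc ρ s :=
  Run.step hi rfl fun s' hs => ⟨_, _, s', fun _ => rfl, hE.guar_refl _, h _ hs⟩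

theorem Run.storeSmall {addr src : ℕ} (hi : P[pc]? = some (.storeSmall addr src))
    (ha : ρ addr < M.smallWords)
    (h : ∀ s', R s s' → G s' { s' with small := Function.update s'.small (ρ addr) (ρ src) } ∧
      Run M C F P R G Q m e (pc + 1) ρ
        { s' with small := Function.update s'.small (ρ addr) (ρ src) }) :
    Run M C F P R G Q (m + 1) (e + 1) pc ρ s :=
  Run.step hi rfl fun s' hs => ⟨_, _, _, fun _ => by
    simp only [Instr.exec, ha, if_true, Thread.advance, Instr.cost], (h _ hs).1, (h _ hs).2⟩

theorem Run.callC {dst v : ℕ} (hi : P[pc]? = some (.callC dst v)) (x : Fin n) (hx : ρ v = x)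
    (h : ∀ s', R s s' →
      G s' { s' with calls := s'.calls ++ [.condition x (C x s'.user)] } ∧
      Run M C F P R G Q m e (pc + 1) (Function.update ρ dst (C x s'.user).toNat)
        { s' with calls := s'.calls ++ [.condition x (C x s'.user)] }) :
    Run M C F P R G Q (m + 1) (e + 1) pc ρ s :=
  Run.step hi rfl fun s' hs => ⟨_, _, _, fun _ => by
    simp only [Instr.exec, hx, x.isLt, dite_true, Thread.advance, Thread.setReg, Instr.cost],
    (h _ hs).1, (h _ hs).2⟩

theorem Run.callF {dst u v : ℕ} (hi : P[pc]? = some (.callF dst u v)) (x y : Fin n)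
    (hx : ρ u = x) (hy : ρ v = y)
    (h : ∀ s', R s s' →
      G s' { s' with
        user := (F x y s'.user).2
        calls := s'.calls ++ [.apply x y (F x y s'.user).1] } ∧
      Run M C F P R G Q m e (pc + 1) (Function.update ρ dst (F x y s'.user).1.toNat)
        { s' with
          user := (F x y s'.user).2
          calls := s'.calls ++ [.apply x y (F x y s'.user).1] }) :
    Run M C F P R G Q (m + 1) (e + 1) pc ρ s :=
  Run.step hi rfl fun s' hs => ⟨_, _, _, fun _ => by
    simp only [Instr.exec, hx, hy, x.isLt, y.isLt, and_self, dite_true, Thread.advance,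
      Thread.setReg, Instr.cost], (h _ hs).1, (h _ hs).2⟩

end Logic

/-! ### Exact arithmetic on words when nothing overflows -/

section ArithmeticRules

variable {n : ℕ} {σ : Type u} {M : Machine} {C : Fin n → σ → Bool}
  {F : Fin n → Fin n → σ → Bool × σ} {P : Program}
variable {R G : Shared n σ → Shared n σ → Prop} {Q : (ℕ → ℕ) → Shared n σ → Prop}
variable {m e pc : ℕ} {ρ : ℕ → ℕ} {s : Shared n σ}

theorem ArithOp.eval_sub_of_le {w a b : ℕ} (hab : b ≤ a) (ha : a < 2 ^ w) :
    ArithOp.sub.eval w a b = a - b := by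
  have : a + (2 ^ w - b) = a - b + 2 ^ w := by omega
  simp only [ArithOp.eval, this, Nat.add_mod_right]
  exact Nat.mod_eq_of_lt (by omega)

theorem Run.add {dst a b : ℕ} (x y : ℕ) (hi : P[pc]? = some (.arith .add dst a b))
    (hE : Protocol R G) (hx : ρ a = x) (hy : ρ b = y) (hxy : x + y < 2 ^ M.wordBits)
    (h : Run M C F P R G Q m e (pc + 1) (Function.update ρ dst (x + y)) s) :
    Run M C F P R G Q (m + 1) (e + 1) pc ρ s :=
  Run.arith _ hi hE (by rw [hx, hy]; exact Nat.mod_eq_of_lt hxy) h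

/-- There is no copy instruction; adding a register that holds `0` replaces it. -/
theorem Run.move {dst a b : ℕ} (x : ℕ) (hi : P[pc]? = some (.arith .add dst a b))
    (hE : Protocol R G) (hx : ρ a = x) (hy : ρ b = 0) (hxw : x < 2 ^ M.wordBits)
    (h : Run M C F P R G Q m e (pc + 1) (Function.update ρ dst x) s) :
    Run M C F P R G Q (m + 1) (e + 1) pc ρ s :=
  Run.add x 0 hi hE hx hy hxw h

theorem Run.sub {dst a b : ℕ} (x y : ℕ) (hi : P[pc]? = some (.arith .sub dst a b))
    (hE : Protocol R G) (hx : ρ a = x) (hy : ρ b = y) (hxy : y ≤ x) (hxw : x < 2 ^ M.wordBits)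
    (h : Run M C F P R G Q m e (pc + 1) (Function.update ρ dst (x - y)) s) :
    Run M C F P R G Q (m + 1) (e + 1) pc ρ s :=
  Run.arith _ hi hE (by rw [hx, hy]; exact ArithOp.eval_sub_of_le hxy hxw) h

theorem Run.div {dst a b : ℕ} (x y : ℕ) (hi : P[pc]? = some (.arith .div dst a b))
    (hE : Protocol R G) (hx : ρ a = x) (hy : ρ b = y) (hxw : x < 2 ^ M.wordBits)
    (h : Run M C F P R G Q m e (pc + 1) (Function.update ρ dst (x / y)) s) :
    Run M C F P R G Q (m + 1) (e + 1) pc ρ s :=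
  Run.arith _ hi hE (by
    rw [hx, hy]; exact Nat.mod_eq_of_lt ((Nat.div_le_self _ _).trans_lt hxw)) h

end ArithmeticRules

/-! ### The program

Small-memory, with `m = n + 1`: the list of `U` from `0` on; prefix sums of the degrees from `m` on;
a `0`-`1`-array and its prefix sums from `2 * m` on; the slots of the vertices from `3 * m` on; the
vertices in the slots from `4 * m` on; the output from `5 * m` on.

Registers: `10` holds `n`, `11`-`13` hold the numbers `0`-`2`, `16`-`20` hold the addresses
of the arrays, `21` the sum `D` of the degrees, `22` the size of `U`, `23` the minimum of `D` and `n`.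
The divide-and-conquer procedure at `47` works on the range from register `3` to register `4`,
with register `15` holding the address of an array of partial sums, and registers `5` and `6` the
sums of the entries before and up to the end of the range. Register `14` determines what is done for
an element of the range (at `75`), and whether the partial sums of the two halves are added up:
in mode `0` for degrees, in mode `1` for the `0`-`1`-array; mode `2` fills with zeros; mode `3` packs
the output; modes `6` and `7` run modes `4` (find slots) and `5` (apply `F`) on adjacency lists. -/

open Instr in
def edgeMapProgram : Program := [
  const 11 0,
  const 12 1,
  const 13 2,
  arith .add 10 1 11,
  arith .add 22 2 11,
  arith .add 16 10 12,
  arith .add 17 16 16,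
  arith .add 18 17 16,
  arith .add 19 18 16,
  arith .add 20 19 16,
  storeSmall 16 11,
  const 14 0,
  arith .add 15 16 11,
  const 3 0,
  arith .add 4 22 11,
  fork,
  jumpIfLt 11 0 46,
  loadSmall 21 16,
  arith .add 23 21 11,
  jumpIfLt 21 10 21,
  arith .add 23 10 11,
  const 14 2,
  arith .add 4 23 12,
  fork,
  jumpIfLt 11 0 46,
  const 14 6,
  arith .add 4 22 11,
  const 5 0,
  arith .add 6 21 11,
  fork,
  jumpIfLt 11 0 46,
  const 14 7,
  fork,
  jumpIfLt 11 0 46,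
  const 14 1,
  arith .add 15 17 11,
  arith .add 4 23 11,
  fork,
  jumpIfLt 11 0 46,
  loadSmall 2 17,
  arith .add 6 2 11,
  const 14 3,
  fork,
  jumpIfLt 11 0 46,
  arith .add 1 20 11,
  halt,
  -- 46: the first child runs the procedure, the second one ends
  jumpIfLt 12 0 48,
  -- 47: the divide-and-conquer procedure
  jumpIfLt 3 4 49,
  halt,
  arith .add 8 3 12,
  jumpIfLt 8 4 52,
  jump 75,
  arith .add 7 3 4,
  arith .div 7 7 13,
  arith .add 8 15 7,
  loadSmall 8 8,
  arith .sub 8 6 8,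
  fork,
  jumpIfLt 0 12 66,
  jumpIfLt 12 0 63,
  arith .add 4 7 11,
  arith .add 6 8 11,
  jump 47,
  arith .add 3 7 11,
  arith .add 5 8 11,
  jump 47,
  -- 66: both halves are done
  jumpIfLt 14 13 68,
  halt,
  arith .add 8 15 3,
  arith .add 9 15 7,
  loadSmall 1 8,
  loadSmall 2 9,
  arith .add 1 1 2,
  storeSmall 8 1,
  halt,
  -- 75: an element of the range
  jumpIfLt 14 12 93,
  jumpIfLt 14 13 48,
  const 8 3,
  jumpIfLt 14 8 101,
  const 8 4,
  jumpIfLt 14 8 104,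
  const 8 5,
  jumpIfLt 14 8 111,
  const 8 6,
  jumpIfLt 14 8 120,
  -- 85: modes 6 and 7
  loadSmall 26 3,
  loadLarge 24 26,
  arith .add 24 24 16,
  arith .sub 14 14 13,
  arith .add 25 5 11,
  arith .sub 4 6 5,
  const 3 0,
  jump 47,
  -- 93: mode 0
  loadSmall 8 3,
  arith .add 9 8 12,
  loadLarge 9 9,
  loadLarge 8 8,
  arith .sub 9 9 8,
  arith .add 8 16 3,
  storeSmall 8 9,
  halt,
  -- 101: mode 2
  arith .add 8 17 3,
  storeSmall 8 11,
  halt,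
  -- 104: mode 3
  jumpIfLt 5 6 106,
  halt,
  arith .add 8 19 3,
  loadSmall 8 8,
  arith .add 9 20 5,
  storeSmall 9 8,
  halt,
  -- 111: mode 4
  arith .add 8 24 3,
  loadLarge 8 8,
  arith .add 9 18 8,
  jumpIfLt 21 10 117,
  storeSmall 9 8,
  halt,
  arith .add 8 25 3,
  storeSmall 9 8,
  halt,
  -- 120: mode 5
  arith .add 8 24 3,
  loadLarge 8 8,
  callC 9 8,
  jumpIfLt 11 9 125,
  halt,
  callF 9 26 8,
  jumpIfLt 11 9 128,
  halt,
  arith .add 9 18 8,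
  loadSmall 9 9,
  arith .add 1 19 9,
  storeSmall 1 8,
  arith .add 1 17 9,
  storeSmall 1 12,
  halt]

/-! ### The divide-and-conquer procedure, for all modes at once -/

section Procedure

variable {n : ℕ} {σ : Type u} {M : Machine} {C : Fin n → σ → Bool}
  {F : Fin n → Fin n → σ → Bool × σ}

/-- The registers that the divide-and-conquer procedure leaves alone hold the values `κ`. -/
structure Ctx (κ ρ : ℕ → ℕ) : Prop where
  eq : ∀ r, 10 ≤ r → ρ r = κ r
  zero : κ 11 = 0
  one : κ 12 = 1
  two : κ 13 = 2

theorem Ctx.update {κ ρ : ℕ → ℕ} (h : Ctx κ ρ) {r : ℕ} (hr : r < 10) (x : ℕ) :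
    Ctx κ (Function.update ρ r x) :=
  ⟨fun r' hr' => by rw [Function.update_of_ne (by omega), h.eq r' hr'], h.zero, h.one, h.two⟩

variable {ι : Type*}

/-- Changes of the shared state by the owners of the elements of `X`, for each set `X`. -/
structure IsAction (A : Set ι → Shared n σ → Shared n σ → Prop) : Prop where
  refl : ∀ X a, A X a a
  trans : ∀ X a b c, A X a b → A X b c → A X a c
  mono : ∀ X Y a b, X ⊆ Y → A X a b → A Y a b

theorem IsAction.protocol {A : Set ι → Shared n σ → Shared n σ → Prop} (h : IsAction A)
    (X Y : Set ι) : Protocol (A X) (A Y) :=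
  ⟨h.refl X, h.trans X, h.refl Y⟩

/-- Ranges within `0, …, H - 1` own subsets of `Z`, and disjoint ranges own disjoint subsets. -/
structure IsOwnership (H : ℕ) (own : ℕ → ℕ → Set ι) (Z : Set ι) : Prop where
  subset : ∀ lo hi, hi ≤ H → own lo hi ⊆ Z
  left : ∀ lo mid hi, lo ≤ mid → mid ≤ hi → hi ≤ H → own lo mid ⊆ own lo hi
  right : ∀ lo mid hi, lo ≤ mid → mid ≤ hi → hi ≤ H → own mid hi ⊆ own lo hi
  disjoint : ∀ lo mid hi, lo ≤ mid → mid ≤ hi → hi ≤ H → Disjoint (own lo mid) (own mid hi)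

/-- Correctness of the divide-and-conquer procedure, from correctness for single elements and
correctness of the combination of two halves. -/
theorem Run.divideAndConquer {A : Set ι → Shared n σ → Shared n σ → Prop} (hA : IsAction A)
    {H : ℕ} {own : ℕ → ℕ → Set ι} {Z : Set ι} (hown : IsOwnership H own Z)
    {κ : ℕ → ℕ} (hw : 2 * H < 2 ^ M.wordBits) (hκw : κ 15 + H < 2 ^ M.wordBits)
    (hκs : κ 15 + H ≤ M.smallWords)
    {Pre : ℕ → ℕ → ℕ → ℕ → Shared n σ → Prop} {Post : ℕ → ℕ → Shared n σ → Prop}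
    {wl : ℕ → ℕ} {dl : ℕ}
    (stable : ∀ lo hi b e s s', lo < hi → hi ≤ H → A (Z \ own lo hi) s s' → Pre lo hi b e s →
      Pre lo hi b e s')
    (split : ∀ lo mid hi b e s, mid = (lo + hi) / 2 → lo < mid → mid < hi → hi ≤ H →
      Pre lo hi b e s →
      Pre lo mid b (ArithOp.sub.eval M.wordBits e (s.small (κ 15 + mid))) s ∧
      Pre mid hi (ArithOp.sub.eval M.wordBits e (s.small (κ 15 + mid))) e s)
    (leaf : ∀ i b e ρ s, i < H → Ctx κ ρ → ρ 3 = i → ρ 5 = b → ρ 6 = e → Pre i (i + 1) b e s →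
      Run M C F edgeMapProgram (A (Z \ own i (i + 1))) (A (own i (i + 1)))
        (fun _ => Post i (i + 1)) (wl i) dl 75 ρ s)
    (combine : ∀ lo mid hi ρ s, mid = (lo + hi) / 2 → lo < mid → mid < hi → hi ≤ H → Ctx κ ρ →
      ρ 3 = lo → ρ 7 = mid → Post lo mid s → Post mid hi s →
      Run M C F edgeMapProgram (A (Z \ own lo hi)) (A (own lo hi)) (fun _ => Post lo hi) 9 9 66 ρ s)
    (h : ℕ) {lo hi b e : ℕ} {ρ : ℕ → ℕ} {s : Shared n σ} (hlt : lo < hi) (hH : hi ≤ H)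
    (hsize : hi - lo ≤ 2 ^ h) (hctx : Ctx κ ρ) (hlo : ρ 3 = lo) (hhi : ρ 4 = hi) (hb : ρ 5 = b)
    (he : ρ 6 = e) (hpre : Pre lo hi b e s) :
    Run M C F edgeMapProgram (A (Z \ own lo hi)) (A (own lo hi)) (fun _ => Post lo hi)
      (∑ i ∈ Finset.Ico lo hi, (wl i + 60) - 30) (dl + 4 + 24 * h) 47 ρ s := by
  have hE := hA.protocol (Z \ own lo hi) (own lo hi)
  have r11 := (hctx.eq 11 (by norm_num)).trans hctx.zero
  have r12 := (hctx.eq 12 (by norm_num)).trans hctx.one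
  have r13 := (hctx.eq 13 (by norm_num)).trans hctx.two
  have r15 := hctx.eq 15 (by norm_num)
  induction h generalizing lo hi b e ρ s with
  | zero =>
    obtain rfl : hi = lo + 1 := by simp at hsize; omega
    have := leaf lo b e (Function.update ρ 8 (lo + 1)) s hH (hctx.update (by norm_num) _)
      (by simpa using hlo) (by simpa using hb) (by simpa using he) hpre
    refine Run.weaken (m := wl lo + 4) (e := dl + 4) ?_ (by simp) (by omega)
    refine Run.jumpIfLt_true rfl hE (by omega) ?_
    refine Run.add lo 1 rfl hE hlo r12 (by omega) ?_
    refine Run.jumpIfLt_false rfl hE (by simp [hhi]) ?_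
    exact Run.jump rfl hE this
  | succ h ih =>
    by_cases h1 : hi = lo + 1
    · refine (ih hlt hH ?_ hctx hlo hhi hb he hpre hE r11 r12 r13 r15).weaken le_rfl (by omega)
      have := Nat.one_le_two_pow (n := h)
      omega
    obtain ⟨mid, hmid⟩ : ∃ mid, mid = (lo + hi) / 2 := ⟨_, rfl⟩
    have hm1 : lo < mid := by omega
    have hm2 : mid < hi := by omega
    rw [pow_succ] at hsize
    have hsum : (∑ i ∈ Finset.Ico lo hi, (wl i + 60)) =
        (∑ i ∈ Finset.Ico lo mid, (wl i + 60)) + ∑ i ∈ Finset.Ico mid hi, (wl i + 60) :=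
      (Finset.sum_Ico_consecutive _ hm1.le hm2.le).symm
    have hpos : ∀ a b, a < b → 60 ≤ ∑ i ∈ Finset.Ico a b, (wl i + 60) := by
      intro a b hab
      refine le_trans ?_ (Finset.single_le_sum (fun _ _ => Nat.zero_le _)
        (Finset.left_mem_Ico.2 hab))
      omega
    have p1 := hpos _ _ hm1
    have p2 := hpos _ _ hm2
    have hle1 := hown.left lo mid hi hm1.le hm2.le hH
    have hle2 := hown.right lo mid hi hm1.le hm2.le hH
    have hdis := hown.disjoint lo mid hi hm1.le hm2.le hH
    have hZ1 := hown.subset lo mid (by omega)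
    have hZ2 := hown.subset mid hi hH
    have hE1 := hA.protocol (Z \ own lo mid) (own lo mid)
    have hE2 := hA.protocol (Z \ own mid hi) (own mid hi)
    -- The credit of `60` per element, less `30`, is an amortization: with `k` elements there are `k
    -- - 1` internal nodes, and each costs `5 + 5 + 10 + 2 + 8 = 30` steps. On a path, such a node
    -- costs `5 + 10 + 1 + 8 = 24`.
    refine Run.weaken
      (m := ((∑ i ∈ Finset.Ico lo mid, (wl i + 60) - 30 + 5) +
        (∑ i ∈ Finset.Ico mid hi, (wl i + 60) - 30 + 5) + 10 + 2) + 8)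
      (e := (dl + 4 + 24 * h + 5 + 10 + 1) + 8) ?_ (by omega) (by omega)
    refine Run.jumpIfLt_true rfl hE (by omega) ?_
    refine Run.add lo 1 rfl hE hlo r12 (by omega) ?_
    refine Run.jumpIfLt_true rfl hE (by simp [hhi]; omega) ?_
    refine Run.add lo hi rfl hE (by simp [hlo]) (by simp [hhi]) (by omega) ?_
    refine Run.div (lo + hi) 2 rfl hE (by simp) (by simp [r13]) (by omega) ?_
    rw [← hmid]
    refine Run.add (κ 15) mid rfl hE (by simp [r15]) (by simp) (by omega) ?_
    refine Run.loadSmall rfl hE (by simp; omega) fun s' hs => ?_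
    simp only [Function.update_self, Function.update_idem]
    replace hpre := stable _ _ _ _ _ _ hlt hH hs hpre
    clear hs
    obtain ⟨hpre1, hpre2⟩ := split lo mid hi b e s' hmid hm1 hm2 hH hpre
    -- The subtraction is executed in all modes, also where the loaded word means nothing; reduction
    -- modulo `2 ^ w` still leaves a word that can be copied.
    have hxw : ArithOp.sub.eval M.wordBits e (s'.small (κ 15 + mid)) < 2 ^ M.wordBits :=
      Nat.mod_lt _ (by positivity)
    refine Run.arith (ArithOp.sub.eval M.wordBits e (s'.small (κ 15 + mid))) rfl hE
      (by simp [he]) ?_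
    generalize ArithOp.sub.eval M.wordBits e (s'.small (κ 15 + mid)) = x at *
    simp only [Function.update_idem]
    -- Since the halves own disjoint parts of `Z`, what one half owns lies outside of what the other
    -- half owns, so each guarantee implies the other rely.
    refine Run.fork (m₁ := ∑ i ∈ Finset.Ico lo mid, (wl i + 60) - 30 + 5)
      (m₂ := ∑ i ∈ Finset.Ico mid hi, (wl i + 60) - 30 + 5) (m₃ := 10)
      (e₁ := dl + 4 + 24 * h + 5) (e₃ := 10) (Q₁ := Post lo mid) (Q₂ := Post mid hi) rfl hE hE1 hE2
      (fun a b => hA.mono _ _ _ _ (Set.sdiff_subset_sdiff_right hle1))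
      (fun a b => hA.mono _ _ _ _ (Set.sdiff_subset_sdiff_right hle2))
      (fun a b => hA.mono _ _ _ _ (Set.subset_sdiff.2 ⟨hZ1, hdis⟩))
      (fun a b => hA.mono _ _ _ _ (Set.subset_sdiff.2 ⟨hZ2, hdis.symm⟩))
      (fun a b => hA.mono _ _ _ _ hle1) (fun a b => hA.mono _ _ _ _ hle2) ?_ ?_ ?_
    · refine Run.jumpIfLt_false rfl hE1 (by simp [r12]) ?_
      refine Run.jumpIfLt_false rfl hE1 (by simp [r12]) ?_
      refine Run.move mid rfl hE1 (by simp) (by simp [r11]) (by omega) ?_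
      refine Run.move x rfl hE1 (by simp) (by simp [r11]) hxw ?_
      refine Run.jump rfl hE1 ?_
      refine ih hm1 (by omega) (by omega) ?_ (by simp [hlo]) (by simp) (by simp [hb]) (by simp)
        hpre1 hE1 (by simp [r11]) (by simp [r12]) (by simp [r13]) (by simp [r15])
      repeat refine Ctx.update ?_ (by norm_num) _
      exact hctx
    · refine Run.jumpIfLt_false rfl hE2 (by simp [r12]) ?_
      refine Run.jumpIfLt_true rfl hE2 (by simp [r12]) ?_
      refine Run.move mid rfl hE2 (by simp) (by simp [r11]) (by omega) ?_
      refine Run.move x rfl hE2 (by simp) (by simp [r11]) hxw ?_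
      refine Run.jump rfl hE2 ?_
      refine ih hm2 hH (by omega) ?_ (by simp) (by simp [hhi]) (by simp) (by simp [he])
        hpre2 hE2 (by simp [r11]) (by simp [r12]) (by simp [r13]) (by simp [r15])
      repeat refine Ctx.update ?_ (by norm_num) _
      exact hctx
    · intro s₂ hp1 hp2
      refine Run.jumpIfLt_true rfl hE (by simp [r12]) ?_
      refine combine lo mid hi _ s₂ hmid hm1 hm2 hH ?_ (by simp [hlo]) (by simp) hp1 hp2
      repeat refine Ctx.update ?_ (by norm_num) _
      exact hctx

end Procedure

/-! ### Partial sums -/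

def partialSum (f : ℕ → ℕ) (i : ℕ) : ℕ := ∑ j ∈ Finset.range i, f j

theorem partialSum_succ (f : ℕ → ℕ) (i : ℕ) : partialSum f (i + 1) = partialSum f i + f i :=
  Finset.sum_range_succ f i

theorem partialSum_mono (f : ℕ → ℕ) : Monotone (partialSum f) :=
  monotone_nat_of_le_succ fun i => by rw [partialSum_succ]; omega

/-- `S` holds the sums of the right halves of all the ranges into which `lo, …, hi - 1` is divided,
each one at the middle of its range; `B` are the partial sums of the whole array. -/
inductive Sums (S B : ℕ → ℕ) : ℕ → ℕ → Prop
  | short {lo hi : ℕ} : hi ≤ lo + 1 → Sums S B lo hi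
  | node {lo mid hi : ℕ} : mid = (lo + hi) / 2 → lo < mid → mid < hi → S mid = B hi - B mid →
      Sums S B lo mid → Sums S B mid hi → Sums S B lo hi

/-- All midpoints lie strictly inside the range. In particular the cell `lo` is free to hold the
total of the range. -/
theorem Sums.congr {S S' B : ℕ → ℕ} {lo hi : ℕ} (h : Sums S B lo hi)
    (hS : ∀ i, lo < i → i < hi → S' i = S i) : Sums S' B lo hi := by
  induction h with
  | short h => exact .short h
  | node h1 h2 h3 h4 _ _ ih1 ih2 =>
    exact .node h1 h2 h3 (by rw [hS _ h2 h3, h4]) (ih1 fun i hi hi' => hS i hi (hi'.trans h3))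
      (ih2 fun i hi hi' => hS i (h2.trans hi) hi')

/-- The midpoint is determined by the ends, so the division of a range is unique. -/
theorem Sums.split {S B : ℕ → ℕ} {lo mid hi : ℕ} (h : Sums S B lo hi) (hm : mid = (lo + hi) / 2)
    (h1 : lo < mid) (h2 : mid < hi) :
    S mid = B hi - B mid ∧ Sums S B lo mid ∧ Sums S B mid hi := by
  cases h with
  | short h => omega
  | node h' h2 h3 h4 h5 h6 =>
    obtain rfl := hm.trans h'.symm
    exact ⟨h4, h5, h6⟩

/-- This is the descending pass: from the prefix sum at the right end and the stored sum of the
right half, the machine computes the prefix sum at the midpoint. -/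
theorem Sums.eval_sub {S B : ℕ → ℕ} {lo mid hi w : ℕ} (h : Sums S B lo hi) (hB : Monotone B)
    (hm : mid = (lo + hi) / 2) (h1 : lo < mid) (h2 : mid < hi) (hw : B hi < 2 ^ w) :
    ArithOp.sub.eval w (B hi) (S mid) = B mid := by
  have := hB h2.le
  rw [(h.split hm h1 h2).1, ArithOp.eval_sub_of_le (by omega) hw]
  omega

/-! ### Summing, clearing and packing arrays in the small-memory -/

section Arrays

variable {n : ℕ} {σ : Type u} {M : Machine} {C : Fin n → σ → Bool}
  {F : Fin n → Fin n → σ → Bool × σ}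

/-- Changes of the words of the small-memory with addresses in `X` only. -/
structure ArrayAction (X : Set ℕ) (s s' : Shared n σ) : Prop where
  large : s'.large = s.large
  user : s'.user = s.user
  calls : s'.calls = s.calls
  small : ∀ a, a ∉ X → s'.small a = s.small a

theorem isAction_arrayAction : IsAction (ArrayAction (n := n) (σ := σ)) where
  refl _ _ := ⟨rfl, rfl, rfl, fun _ _ => rfl⟩
  trans _ _ _ _ h h' := ⟨h'.large.trans h.large, h'.user.trans h.user, h'.calls.trans h.calls,
    fun a ha => (h'.small a ha).trans (h.small a ha)⟩
  mono _ _ _ _ hX h := ⟨h.large, h.user, h.calls, fun a ha => h.small a fun ha' => ha (hX ha')⟩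

theorem ArrayAction.store {X : Set ℕ} (s : Shared n σ) {a : ℕ} (ha : a ∈ X) (x : ℕ) :
    ArrayAction X s { s with small := Function.update s.small a x } :=
  ⟨rfl, rfl, rfl, fun b hb => Function.update_of_ne (by rintro rfl; exact hb ha) _ _⟩

/-- With `f i = a + i` each index owns its cell of an array. With `f i = o + partialSum val i` it
owns its cells of a packed output, possibly none. -/
theorem isOwnership_Ico {f : ℕ → ℕ} (hf : Monotone f) (H : ℕ) :
    IsOwnership H (fun lo hi => Set.Ico (f lo) (f hi)) (Set.Ico (f 0) (f H)) where
  subset _ _ h := Set.Ico_subset_Ico (hf (Nat.zero_le _)) (hf h)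
  left _ _ _ _ h _ := Set.Ico_subset_Ico le_rfl (hf h)
  right _ _ _ h _ _ := Set.Ico_subset_Ico (hf h) le_rfl
  disjoint _ _ _ _ _ _ := Set.Ico_disjoint_Ico_same

/-- Nothing is done to combine two halves in modes from `2` on. -/
theorem Run.combine_nothing {R G : Shared n σ → Shared n σ → Prop} {Q : Shared n σ → Prop}
    (hE : Protocol R G) {κ ρ : ℕ → ℕ} {s : Shared n σ} (hctx : Ctx κ ρ) (hmode : 2 ≤ κ 14)
    (hQ : ∀ s', R s s' → Q s') : Run M C F edgeMapProgram R G (fun _ => Q) 9 9 66 ρ s := by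
  refine Run.weaken (m := 2) (e := 2) ?_ (by norm_num) (by norm_num)
  refine Run.jumpIfLt_false rfl hE ?_ ?_
  · rw [hctx.eq 13 (by norm_num), hctx.two, hctx.eq 14 (by norm_num)]
    exact hmode
  · exact Run.halt rfl hE hQ

/-- The summation of an array in place, with partial sums as described by `Sums`. -/
theorem Run.sums {K a : ℕ} {val κ : ℕ → ℕ} (hmode : κ 14 < 2) (ha : κ 15 = a)
    (hw : 2 * K < 2 ^ M.wordBits) (haw : a + K < 2 ^ M.wordBits) (has : a + K ≤ M.smallWords)
    (hsum : partialSum val K < 2 ^ M.wordBits) {Pre : ℕ → Shared n σ → Prop} {wl dl : ℕ}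
    (stable : ∀ i s s', i < K →
      ArrayAction (Set.Ico a (a + K) \ Set.Ico (a + i) (a + i + 1)) s s' → Pre i s → Pre i s')
    (leaf : ∀ i ρ s, i < K → Ctx κ ρ → ρ 3 = i → Pre i s → Run M C F edgeMapProgram
      (ArrayAction (Set.Ico a (a + K) \ Set.Ico (a + i) (a + i + 1)))
      (ArrayAction (Set.Ico (a + i) (a + i + 1))) (fun _ s => s.small (a + i) = val i) wl dl 75 ρ s)
    {h : ℕ} (hK : 0 < K) (hh : K ≤ 2 ^ h) {ρ : ℕ → ℕ} {s : Shared n σ} (hctx : Ctx κ ρ)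
    (hlo : ρ 3 = 0) (hhi : ρ 4 = K) (hpre : ∀ i, i < K → Pre i s) :
    Run M C F edgeMapProgram (ArrayAction ∅) (ArrayAction (Set.Ico a (a + K)))
      (fun _ s => s.small a = partialSum val K ∧
        Sums (fun i => s.small (a + i)) (partialSum val) 0 K)
      (K * (wl + 60)) (dl + 4 + 24 * h) 47 ρ s := by
  have hA := isAction_arrayAction (n := n) (σ := σ)
  have hmono := partialSum_mono val
  have post_stable : ∀ lo hi (s s' : Shared n σ), hi ≤ K →
      ArrayAction (Set.Ico a (a + K) \ Set.Ico (a + lo) (a + hi)) s s' →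
      Sums (fun i => s.small (a + i)) (partialSum val) lo hi →
      Sums (fun i => s'.small (a + i)) (partialSum val) lo hi :=
    fun lo hi s s' hK h hs => hs.congr fun i h1 h2 => h.small _ (by simp; omega)
  have key := Run.divideAndConquer (M := M) (C := C) (F := F) hA
    (isOwnership_Ico (f := fun i => a + i) (fun i j h => by simpa using h) K) (κ := κ)
    (Pre := fun lo hi _ _ s => ∀ i, lo ≤ i → i < hi → Pre i s)
    (Post := fun lo hi s => s.small (a + lo) = partialSum val hi - partialSum val lo ∧
      Sums (fun i => s.small (a + i)) (partialSum val) lo hi)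
    (wl := fun _ => wl) (dl := dl) hw (by omega) (by omega)
    (fun lo hi b e s s' h1 h2 h3 h4 i hi1 hi2 => stable i s s' (by omega)
      (hA.mono _ _ _ _ (Set.sdiff_subset_sdiff_right
        (Set.Ico_subset_Ico (by omega) (by simp; omega))) h3) (h4 i hi1 hi2))
    (fun lo mid hi b e s _ h1 h2 h3 h4 =>
      ⟨fun i hi hi' => h4 i hi (by omega), fun i hi hi' => h4 i (by omega) hi'⟩)
    (fun i b e ρ s hi hctx h3 _ _ hp =>
      (leaf i ρ s hi hctx h3 (hp i le_rfl (by omega))).mono (fun _ _ h => h) (fun _ _ h => h)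
        (fun _ s h => ⟨by rw [h, partialSum_succ]; omega, .short le_rfl⟩) le_rfl le_rfl)
    ?_ h hK le_rfl (by omega) hctx hlo hhi rfl rfl (fun i _ hi => hpre i hi)
  · refine key.mono (fun x y h => ?_) (fun _ _ h => h) (fun ρ s h => ?_) ?_ le_rfl
    · simpa using h
    · simpa [partialSum] using h
    · simp
  · intro lo mid hi ρ s hmid h1 h2 hi' hctx hlo h7 hp1 hp2
    have hE := hA.protocol (Set.Ico a (a + K) \ Set.Ico (a + lo) (a + hi))
      (Set.Ico (a + lo) (a + hi))
    have r14 := hctx.eq 14 (by norm_num)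
    have r13 := (hctx.eq 13 (by norm_num)).trans hctx.two
    have r15 := (hctx.eq 15 (by norm_num)).trans ha
    have m1 := hmono h1.le
    have m2 := hmono h2.le
    have m3 := hmono hi'
    have hsm : ∀ s s' : Shared n σ,
        ArrayAction (Set.Ico a (a + K) \ Set.Ico (a + lo) (a + hi)) s s' →
        ∀ i, lo ≤ i → i < hi → s'.small (a + i) = s.small (a + i) :=
      fun s s' h i h1 h2 => h.small _ (by simp; omega)
    refine Run.weaken (m := 8) (e := 8) ?_ (by norm_num) (by norm_num)
    refine Run.jumpIfLt_true rfl hE (by omega) ?_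
    refine Run.add a lo rfl hE r15 hlo (by omega) ?_
    refine Run.add a mid rfl hE (by simp [r15]) (by simp [h7]) (by omega) ?_
    refine Run.loadSmall rfl hE (by simp; omega) fun s1 hs1 => ?_
    refine Run.loadSmall rfl hE (by simp; omega) fun s2 hs2 => ?_
    refine Run.add (partialSum val mid - partialSum val lo) (partialSum val hi - partialSum val mid)
      rfl hE ?_ ?_ (by omega) ?_
    · simp [hsm _ _ hs1 lo le_rfl (by omega), hp1.1]
    · simp [hsm _ _ hs1 mid (by omega) (by omega), hsm _ _ hs2 mid (by omega) (by omega), hp2.1]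
    refine Run.storeSmall rfl (by simp; omega) fun s3 hs3 => ⟨?_, ?_⟩
    · exact ArrayAction.store _ (by simp; omega) _
    · refine Run.halt rfl hE fun s4 hs4 => ⟨?_, ?_⟩
      · rw [hsm _ _ hs4 lo le_rfl (by omega)]
        simp
        omega
      -- The only write goes to the cell `lo`, which is not a midpoint; the cell `mid` still holds
      -- the sum of the right half and becomes the entry of the new node.
      · refine Sums.congr (S := fun i => s.small (a + i)) ?_ fun i hi1 hi2 => ?_
        · exact .node hmid h1 h2 hp2.1 hp1.2 hp2.2
        · rw [hsm _ _ hs4 i hi1.le hi2, ← hsm _ _ hs1 i hi1.le hi2, ← hsm _ _ hs2 i hi1.le hi2,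
            ← hsm _ _ hs3 i hi1.le hi2]
          exact Function.update_of_ne (by simp; omega) _ _

/-- Mode `0`. -/
theorem Run.degreeSums {K a : ℕ} {L ul deg κ : ℕ → ℕ} (hmode : κ 14 = 0) (ha : κ 15 = a)
    (ha' : κ 16 = a) (hKa : K ≤ a)
    (hw : 2 * K < 2 ^ M.wordBits) (haw : a + K < 2 ^ M.wordBits) (has : a + K ≤ M.smallWords)
    (hsum : partialSum deg K < 2 ^ M.wordBits)
    (hdeg : ∀ i, i < K → L (ul i + 1) = L (ul i) + deg i)
    (hL : ∀ i, i < K → L (ul i + 1) < 2 ^ M.wordBits)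
    (hul : ∀ i, i < K → ul i + 1 < 2 ^ M.wordBits)
    {h : ℕ} (hK : 0 < K) (hh : K ≤ 2 ^ h) {ρ : ℕ → ℕ} {s : Shared n σ} (hctx : Ctx κ ρ)
    (hlo : ρ 3 = 0) (hhi : ρ 4 = K) (hlarge : s.large = L) (hlist : ∀ i, i < K → s.small i = ul i) :
    Run M C F edgeMapProgram (ArrayAction ∅) (ArrayAction (Set.Ico a (a + K)))
      (fun _ s => s.small a = partialSum deg K ∧
        Sums (fun i => s.small (a + i)) (partialSum deg) 0 K)
      (K * (9 + 60)) (9 + 4 + 24 * h) 47 ρ s := by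
  have hA := isAction_arrayAction (n := n) (σ := σ)
  refine Run.sums (Pre := fun i s => s.large = L ∧ s.small i = ul i) (by omega) ha hw haw has hsum
    ?_ ?_ hK hh hctx hlo hhi fun i hi => ⟨hlarge, hlist i hi⟩
  -- The list occupies addresses below `K ≤ a`, so the summation does not touch it.
  · exact fun i s s' hi h hp => ⟨h.large.trans hp.1, (h.small i (by simp; omega)).trans hp.2⟩
  · intro i ρ s hi hctx h3 ⟨h1, h2⟩
    have hE := hA.protocol (Set.Ico a (a + K) \ Set.Ico (a + i) (a + i + 1))
      (Set.Ico (a + i) (a + i + 1))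
    have r14 := hctx.eq 14 (by norm_num)
    have r12 := (hctx.eq 12 (by norm_num)).trans hctx.one
    have r16 := (hctx.eq 16 (by norm_num)).trans ha'
    have hd := hdeg i hi
    have hl := hL i hi
    refine Run.jumpIfLt_true rfl hE (by omega) ?_
    refine Run.loadSmall rfl hE (by omega) fun s1 hs1 => ?_
    rw [h3, hs1.small i (by simp; omega), h2]
    refine Run.add (ul i) 1 rfl hE (by simp) (by simp [r12]) (hul i hi) ?_
    refine Run.loadLarge rfl hE fun s2 hs2 => ?_
    refine Run.loadLarge rfl hE fun s3 hs3 => ?_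
    rw [hs3.large, hs2.large, hs1.large, h1]
    refine Run.sub (L (ul i + 1)) (L (ul i)) rfl hE (by simp) (by simp) (by omega) hl ?_
    refine Run.add a i rfl hE (by simp [r16]) (by simp [h3]) (by omega) ?_
    refine Run.storeSmall rfl (by simp; omega) fun s4 hs4 => ⟨?_, ?_⟩
    · exact ArrayAction.store _ (by simp) _
    · refine Run.halt rfl hE fun s5 hs5 => ?_
      rw [hs5.small _ (by simp)]
      simp
      omega

/-- Mode `1`. -/
theorem Run.arraySums {K a : ℕ} {val κ : ℕ → ℕ} (hmode : κ 14 = 1) (ha : κ 15 = a)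
    (hw : 2 * K < 2 ^ M.wordBits) (haw : a + K < 2 ^ M.wordBits) (has : a + K ≤ M.smallWords)
    (hsum : partialSum val K < 2 ^ M.wordBits)
    {h : ℕ} (hK : 0 < K) (hh : K ≤ 2 ^ h) {ρ : ℕ → ℕ} {s : Shared n σ} (hctx : Ctx κ ρ)
    (hlo : ρ 3 = 0) (hhi : ρ 4 = K) (hval : ∀ i, i < K → s.small (a + i) = val i) :
    Run M C F edgeMapProgram (ArrayAction ∅) (ArrayAction (Set.Ico a (a + K)))
      (fun _ s => s.small a = partialSum val K ∧
        Sums (fun i => s.small (a + i)) (partialSum val) 0 K)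
      (K * (3 + 60)) (3 + 4 + 24 * h) 47 ρ s := by
  have hA := isAction_arrayAction (n := n) (σ := σ)
  refine Run.sums (Pre := fun i s => s.small (a + i) = val i) (by omega) ha hw haw has hsum
    ?_ ?_ hK hh hctx hlo hhi hval
  · exact fun i s s' hi h hp => (h.small _ (by simp)).trans hp
  · intro i ρ s hi hctx h3 h1
    have hE := hA.protocol (Set.Ico a (a + K) \ Set.Ico (a + i) (a + i + 1))
      (Set.Ico (a + i) (a + i + 1))
    have r14 := hctx.eq 14 (by norm_num)
    have r12 := (hctx.eq 12 (by norm_num)).trans hctx.one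
    have r13 := (hctx.eq 13 (by norm_num)).trans hctx.two
    refine Run.jumpIfLt_false rfl hE (by omega) ?_
    refine Run.jumpIfLt_true rfl hE (by omega) ?_
    exact Run.halt rfl hE fun s1 hs1 => (hs1.small _ (by simp)).trans h1

/-- Mode `2`. -/
theorem Run.zeros {K a : ℕ} {κ : ℕ → ℕ} (hmode : κ 14 = 2) (ha : κ 17 = a)
    (hw : 2 * K < 2 ^ M.wordBits) (hw4 : 4 < 2 ^ M.wordBits)
    (hκw : κ 15 + K < 2 ^ M.wordBits) (hκs : κ 15 + K ≤ M.smallWords)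
    (haw : a + K < 2 ^ M.wordBits) (has : a + K ≤ M.smallWords)
    {h : ℕ} (hK : 0 < K) (hh : K ≤ 2 ^ h) {ρ : ℕ → ℕ} {s : Shared n σ} (hctx : Ctx κ ρ)
    (hlo : ρ 3 = 0) (hhi : ρ 4 = K) :
    Run M C F edgeMapProgram (ArrayAction ∅) (ArrayAction (Set.Ico a (a + K)))
      (fun _ s => ∀ i, i < K → s.small (a + i) = 0) (K * (7 + 60)) (7 + 4 + 24 * h) 47 ρ s := by
  have hA := isAction_arrayAction (n := n) (σ := σ)
  have key := Run.divideAndConquer (M := M) (C := C) (F := F) hA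
    (isOwnership_Ico (f := fun i => a + i) (fun i j h => by simpa using h) K) (κ := κ)
    (Pre := fun lo hi _ _ s => True)
    (Post := fun lo hi s => ∀ i, lo ≤ i → i < hi → s.small (a + i) = 0)
    (wl := fun _ => 7) (dl := 7) hw (by omega) (by omega) (fun _ _ _ _ _ _ _ _ _ _ => trivial)
    (fun _ _ _ _ _ _ _ _ _ _ _ => ⟨trivial, trivial⟩) ?_ ?_ h hK le_rfl (by omega) hctx hlo hhi
    rfl rfl trivial (s := s)
  · refine key.mono (fun x y h => ?_) (fun _ _ h => h) (fun ρ s h i hi => h i (Nat.zero_le i) hi)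
      ?_ le_rfl
    · simpa using h
    · simp
  · intro i b e ρ s hi hctx h3 _ _ _
    have hE := hA.protocol (Set.Ico (a + 0) (a + K) \ Set.Ico (a + i) (a + (i + 1)))
      (Set.Ico (a + i) (a + (i + 1)))
    have r11 := (hctx.eq 11 (by norm_num)).trans hctx.zero
    have r12 := (hctx.eq 12 (by norm_num)).trans hctx.one
    have r13 := (hctx.eq 13 (by norm_num)).trans hctx.two
    have r14 := (hctx.eq 14 (by norm_num)).trans hmode
    have r17 := (hctx.eq 17 (by norm_num)).trans ha
    refine Run.jumpIfLt_false rfl hE (by omega) ?_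
    refine Run.jumpIfLt_false rfl hE (by omega) ?_
    refine Run.const rfl hE (by omega) ?_
    refine Run.jumpIfLt_true rfl hE (by simp [r14]) ?_
    refine Run.add a i rfl hE (by simp [r17]) (by simp [h3]) (by omega) ?_
    refine Run.storeSmall rfl (by simp; omega) fun s1 hs1 => ⟨?_, ?_⟩
    · exact ArrayAction.store _ (by simp) _
    · refine Run.halt rfl hE fun s2 hs2 j hj1 hj2 => ?_
      obtain rfl : i = j := by omega
      rw [hs2.small _ (by simp)]
      simp [r11]
  · intro lo mid hi ρ s _ h1 h2 hH hctx _ _ hp1 hp2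
    refine Run.combine_nothing (hA.protocol _ _) hctx (by omega) fun s' hs i hi1 hi2 => ?_
    rw [hs.small _ (by simp; omega)]
    rcases lt_or_ge i mid with h | h
    · exact hp1 i hi1 h
    · exact hp2 i h hi2

/-- Mode `3`. -/
theorem Run.pack {K a v o : ℕ} {val vert κ : ℕ → ℕ} (hmode : κ 14 = 3) (ha : κ 15 = a)
    (hv : κ 19 = v) (ho : κ 20 = o) (hav : a + K ≤ o) (hvo : v + K ≤ o)
    (hw : 2 * K < 2 ^ M.wordBits) (hw4 : 4 < 2 ^ M.wordBits)
    (haw : o + K < 2 ^ M.wordBits) (has : o + K ≤ M.smallWords) (hsum : partialSum val K ≤ K)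
    {h : ℕ} (hK : 0 < K) (hh : K ≤ 2 ^ h) {ρ : ℕ → ℕ} {s : Shared n σ} (hctx : Ctx κ ρ)
    (hlo : ρ 3 = 0) (hhi : ρ 4 = K) (hb : ρ 5 = 0) (he : ρ 6 = partialSum val K)
    (hS : Sums (fun i => s.small (a + i)) (partialSum val) 0 K)
    (hvert : ∀ i, i < K → s.small (v + i) = vert i) :
    Run M C F edgeMapProgram (ArrayAction ∅) (ArrayAction (Set.Ico o (o + partialSum val K)))
      (fun _ s => ∀ i, i < K → 0 < val i → s.small (o + partialSum val i) = vert i)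
      (K * (12 + 60)) (12 + 4 + 24 * h) 47 ρ s := by
  have hA := isAction_arrayAction (n := n) (σ := σ)
  have hmono := partialSum_mono val
  -- An index with a positive value has its output cell among those owned by any range that contains
  -- it, so the environment preserves that cell.
  have hout : ∀ lo hi (s s' : Shared n σ), hi ≤ K →
      ArrayAction (Set.Ico (o + partialSum val 0) (o + partialSum val K) \
        Set.Ico (o + partialSum val lo) (o + partialSum val hi)) s s' →
      ∀ i, lo ≤ i → i < hi → 0 < val i →
        s'.small (o + partialSum val i) = s.small (o + partialSum val i) := by
    intro lo hi s s' hK h i h1 h2 h3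
    have m1 := hmono h1
    have m2 := hmono (Nat.succ_le_of_lt h2)
    rw [Nat.succ_eq_add_one, partialSum_succ] at m2
    exact h.small _ (by simp; omega)
  have key := Run.divideAndConquer (M := M) (C := C) (F := F) hA
    (isOwnership_Ico (f := fun i => o + partialSum val i)
      (fun i j h => by simpa using hmono h) K) (κ := κ)
    (Pre := fun lo hi b e s => b = partialSum val lo ∧ e = partialSum val hi ∧
      Sums (fun i => s.small (a + i)) (partialSum val) lo hi ∧
      ∀ i, lo ≤ i → i < hi → s.small (v + i) = vert i)
    (Post := fun lo hi s => ∀ i, lo ≤ i → i < hi → 0 < val i →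
      s.small (o + partialSum val i) = vert i)
    (wl := fun _ => 12) (dl := 12) hw (by omega) (by omega) ?_ ?_ ?_ ?_ h hK le_rfl (by omega) hctx
    hlo hhi hb he (s := s) ⟨rfl, rfl, hS, fun i _ hi => hvert i hi⟩
  · refine key.mono (fun x y h => ?_) (fun x y h => ?_) (fun ρ s h i hi => h i (Nat.zero_le i) hi)
      ?_ le_rfl
    · simpa using h
    · simpa [partialSum] using h
    · simp
  · rintro lo hi b e s s' h1 h2 h3 ⟨h4, h5, h6, h7⟩
    refine ⟨h4, h5, h6.congr fun i h8 h9 => h3.small _ ?_, fun i h8 h9 => ?_⟩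
    · simp
      omega
    · rw [h3.small _ (by simp; omega), h7 i h8 h9]
  · rintro lo mid hi b e s hm h1 h2 h3 ⟨rfl, rfl, h6, h7⟩
    have := h6.eval_sub hmono hm h1 h2 (w := M.wordBits)
      (lt_of_le_of_lt (hmono h3) (by omega))
    rw [ha, this]
    obtain ⟨-, h8, h9⟩ := h6.split hm h1 h2
    exact ⟨⟨rfl, rfl, h8, fun i hi1 hi2 => h7 i hi1 (by omega)⟩,
      ⟨rfl, rfl, h9, fun i hi1 hi2 => h7 i (by omega) hi2⟩⟩
  · rintro i b e ρ s hi hctx h3 hb he ⟨rfl, rfl, -, h7⟩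
    have hE := hA.protocol (Set.Ico (o + partialSum val 0) (o + partialSum val K) \
      Set.Ico (o + partialSum val i) (o + partialSum val (i + 1)))
      (Set.Ico (o + partialSum val i) (o + partialSum val (i + 1)))
    have r12 := (hctx.eq 12 (by norm_num)).trans hctx.one
    have r13 := (hctx.eq 13 (by norm_num)).trans hctx.two
    have r14 := (hctx.eq 14 (by norm_num)).trans hmode
    have r19 := (hctx.eq 19 (by norm_num)).trans hv
    have r20 := (hctx.eq 20 (by norm_num)).trans ho
    have m1 := hmono (Nat.succ_le_of_lt hi)
    rw [Nat.succ_eq_add_one, partialSum_succ] at m1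
    rw [partialSum_succ] at he
    refine Run.jumpIfLt_false rfl hE (by omega) ?_
    refine Run.jumpIfLt_false rfl hE (by omega) ?_
    refine Run.const rfl hE (by omega) ?_
    refine Run.jumpIfLt_false rfl hE (by simp [r14]) ?_
    refine Run.const rfl hE (by omega) ?_
    refine Run.jumpIfLt_true rfl hE (by simp [r14]) ?_
    -- Summation has overwritten the entries of the array, so whether this entry is positive is read
    -- off from the prefix sums on its two sides, in registers `5` and `6`.
    by_cases hval : 0 < val i
    · refine Run.jumpIfLt_true rfl hE (by simp [hb, he, hval]) ?_
      refine Run.add v i rfl hE (by simp [r19]) (by simp [h3]) (by omega) ?_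
      refine Run.loadSmall rfl hE (by simp; omega) fun s1 hs1 => ?_
      refine Run.add o (partialSum val i) rfl hE (by simp [r20]) (by simp [hb]) (by omega) ?_
      refine Run.storeSmall rfl (by simp; omega) fun s2 hs2 => ⟨?_, ?_⟩
      · exact ArrayAction.store _ (by simp [partialSum_succ, hval]) _
      · refine Run.halt rfl hE fun s3 hs3 j hj1 hj2 _ => ?_
        obtain rfl : i = j := by omega
        rw [hout i (i + 1) _ _ hi hs3 i le_rfl (by omega) hval]
        simp [hs1.small (v + i) (by simp; omega), h7 i le_rfl (by omega)]
    · refine Run.jumpIfLt_false rfl hE (by simp [hb, he]; omega) ?_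
      refine Run.weaken (m := 1) (e := 1) ?_ (by norm_num) (by norm_num)
      refine Run.halt rfl hE fun s3 hs3 j hj1 hj2 h => ?_
      obtain rfl : i = j := by omega
      exact absurd h hval
  · intro lo mid hi ρ s _ h1 h2 hH hctx _ _ hp1 hp2
    refine Run.combine_nothing (hA.protocol _ _) hctx (by omega) fun s' hs i hi1 hi2 h3 => ?_
    rw [hout lo hi _ _ hH hs i hi1 hi2 h3]
    rcases lt_or_ge i mid with h | h
    · exact hp1 i hi1 h h3
    · exact hp2 i h hi2 h3

end Arrays

/-! ### Adjacency lists -/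

/-- The number at position `j` in the adjacency list of the `i`-th vertex of the list `ul`. -/
def adjacent (n : ℕ) (L ul : ℕ → ℕ) (i j : ℕ) : ℕ := L (n + 1 + L (ul i) + j)

/-- A list `ul` of `k` vertices with degrees `deg` in a graph in compressed sparse row format. -/
structure IsVertexList (n k : ℕ) (L ul deg : ℕ → ℕ) : Prop where
  card_le : k ≤ n
  lt : ∀ i, i < k → ul i < n
  injective : ∀ i i', i < k → i' < k → ul i = ul i' → i = i'
  offset_succ : ∀ i, i < k → L (ul i + 1) = L (ul i) + deg i
  offset_le : ∀ i, i < k → L (ul i + 1) ≤ n * n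
  deg_le : ∀ i, i < k → deg i ≤ n
  adjacent_lt : ∀ i j, i < k → j < deg i → adjacent n L ul i j < n
  adjacent_injective : ∀ i j j', i < k → j < deg i → j' < deg i →
    adjacent n L ul i j = adjacent n L ul i j' → j = j'

/-- There are at most `n` lists of length at most `n`. This is what makes all arithmetic on edge
numbers exact. -/
theorem IsVertexList.partialSum_le {n k : ℕ} {L ul deg : ℕ → ℕ} (h : IsVertexList n k L ul deg) :
    partialSum deg k ≤ n * n :=
  calc partialSum deg k ≤ ∑ _j ∈ Finset.range k, n :=
        Finset.sum_le_sum fun i hi => h.deg_le i (Finset.mem_range.1 hi)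
    _ = k * n := by simp
    _ ≤ n * n := Nat.mul_le_mul_right n h.card_le

/-- The registers during the processing of one adjacency list. -/
def adjacencyCtx (κ : ℕ → ℕ) (x b u : ℕ) (r : ℕ) : ℕ :=
  if r = 14 then κ 14 - 2 else if r = 24 then x else if r = 25 then b else if r = 26 then u else κ r

section Edges

variable {n : ℕ} {σ : Type u} {M : Machine} {C : Fin n → σ → Bool}
  {F : Fin n → Fin n → σ → Bool × σ}

/-- From an element of the list to its adjacency list, in modes `6` and `7`. -/
theorem Run.adjacencyList {R G : Shared n σ → Shared n σ → Prop} {Q : (ℕ → ℕ) → Shared n σ → Prop}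
    {m e k : ℕ} {L ul deg κ ρ : ℕ → ℕ} {s : Shared n σ} (hE : Protocol R G)
    (hin : IsVertexList n k L ul deg) (hw : 2 * (n * n) + 8 * (n + 1) < 2 ^ M.wordBits)
    (hs : 6 * (n + 1) ≤ M.smallWords) (hmode : 6 ≤ κ 14) (hmode' : κ 14 ≤ 7)
    (h16 : κ 16 = n + 1) {i : ℕ} (hi : i < k) (hctx : Ctx κ ρ) (h3 : ρ 3 = i)
    (h5 : ρ 5 = partialSum deg i) (h6 : ρ 6 = partialSum deg (i + 1))
    (hR : ∀ s', R s s' → s'.large = L ∧ s'.small i = ul i)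
    (h : ∀ s' ρ', R s s' → Ctx (adjacencyCtx κ (n + 1 + L (ul i)) (partialSum deg i) (ul i)) ρ' →
      ρ' 3 = 0 → ρ' 4 = deg i → Run M C F edgeMapProgram R G Q m e 47 ρ' s') :
    Run M C F edgeMapProgram R G Q (m + 18) (e + 18) 75 ρ s := by
  have r11 := (hctx.eq 11 (by norm_num)).trans hctx.zero
  have r12 := (hctx.eq 12 (by norm_num)).trans hctx.one
  have r13 := (hctx.eq 13 (by norm_num)).trans hctx.two
  have r14 := hctx.eq 14 (by norm_num)
  have r16 := (hctx.eq 16 (by norm_num)).trans h16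
  have hdeg := hin.offset_succ i hi
  have hoff := hin.offset_le i hi
  have hcard := hin.card_le
  have hsum := hin.partialSum_le
  have hmono := partialSum_mono deg (Nat.succ_le_of_lt hi)
  rw [Nat.succ_eq_add_one, partialSum_succ] at hmono
  rw [partialSum_succ] at h6
  refine Run.jumpIfLt_false rfl hE (by omega) ?_
  refine Run.jumpIfLt_false rfl hE (by omega) ?_
  refine Run.const rfl hE (by omega) ?_
  refine Run.jumpIfLt_false rfl hE (by simp [r14]; omega) ?_
  refine Run.const rfl hE (by omega) ?_
  refine Run.jumpIfLt_false rfl hE (by simp [r14]; omega) ?_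
  refine Run.const rfl hE (by omega) ?_
  refine Run.jumpIfLt_false rfl hE (by simp [r14]; omega) ?_
  refine Run.const rfl hE (by omega) ?_
  refine Run.jumpIfLt_false rfl hE (by simp [r14]; omega) ?_
  refine Run.loadSmall rfl hE (by simp; omega) fun s1 hs1 => ?_
  simp only [Function.update_idem]
  have e1 : s1.small (Function.update ρ 8 6 3) = ul i := by
    simp [h3, (hR _ hs1).2]
  rw [e1]
  refine Run.loadLarge rfl hE fun s2 hs2 => ?_
  have hs2 := hE.rely_trans _ _ _ hs1 hs2
  rw [Function.update_self, (hR _ hs2).1]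
  refine Run.add (L (ul i)) (n + 1) rfl hE (by simp) (by simp [r16]) (by omega) ?_
  refine Run.sub (κ 14) 2 rfl hE (by simp [r14]) (by simp [r13]) (by omega) (by omega) ?_
  refine Run.move (partialSum deg i) rfl hE (by simp [h5]) (by simp [r11]) (by omega) ?_
  -- The degree is the difference of the prefix sums carried by the descent, so the next offset need
  -- not be loaded.
  refine Run.sub (partialSum deg i + deg i) (partialSum deg i) rfl hE (by simp [h6]) (by simp [h5])
    (by omega) (by omega) ?_
  refine Run.const rfl hE (by omega) ?_
  refine Run.jump rfl hE ?_
  refine h _ _ hs2 ⟨fun r hr => ?_, ?_, ?_, ?_⟩ (by simp) (by simp)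
  · simp only [adjacencyCtx, Function.update_apply]
    have e := hctx.eq r hr
    have a1 : r ≠ 3 := by omega
    have a2 : r ≠ 4 := by omega
    have a3 : r ≠ 8 := by omega
    simp only [a1, a2, a3, if_false]
    split_ifs <;> omega
  · simpa [adjacencyCtx] using hctx.zero
  · simpa [adjacencyCtx] using hctx.one
  · simpa [adjacencyCtx] using hctx.two

/-- One action for each pair `(i, j)` of an element of the list and a position in its adjacency
list, in modes `6` and `7`. -/
theorem Run.forEdges {A : Set (ℕ × ℕ) → Shared n σ → Shared n σ → Prop} (hA : IsAction A)
    {k : ℕ} {L ul deg κ : ℕ → ℕ}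
    (hin : IsVertexList n k L ul deg) (hw : 2 * (n * n) + 8 * (n + 1) < 2 ^ M.wordBits)
    (hs : 6 * (n + 1) ≤ M.smallWords) (hmode : 6 ≤ κ 14) (hmode' : κ 14 ≤ 7)
    (h15 : κ 15 = n + 1) (h16 : κ 16 = n + 1)
    (hlarge : ∀ X s s', A X s s' → s'.large = s.large)
    (hsmall : ∀ X s s', A X s s' → ∀ a, a < 2 * (n + 1) → s'.small a = s.small a)
    {Pre Post : ℕ → ℕ → Shared n σ → Prop}
    (pre_stable : ∀ i j s s', i < k → j < deg i → A {(i, j)}ᶜ s s' → Pre i j s → Pre i j s')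
    (post_stable : ∀ i j s s', i < k → j < deg i → A {(i, j)}ᶜ s s' → Post i j s → Post i j s')
    {we : ℕ}
    (edge : ∀ i j ρ s, i < k → j < deg i →
      Ctx (adjacencyCtx κ (n + 1 + L (ul i)) (partialSum deg i) (ul i)) ρ → ρ 3 = j →
      s.large = L → Pre i j s → Run M C F edgeMapProgram (A {(i, j)}ᶜ) (A {(i, j)})
        (fun _ => Post i j) we we 75 ρ s)
    {h : ℕ} (hk : 0 < k) (hh : n ≤ 2 ^ h) {ρ : ℕ → ℕ} {s : Shared n σ} (hctx : Ctx κ ρ)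
    (h3 : ρ 3 = 0) (h4 : ρ 4 = k) (h5 : ρ 5 = 0) (h6 : ρ 6 = partialSum deg k)
    (hL : s.large = L) (hlist : ∀ i, i < k → s.small i = ul i)
    (hS : Sums (fun i => s.small (n + 1 + i)) (partialSum deg) 0 k)
    (hpre : ∀ i j, i < k → j < deg i → Pre i j s) :
    Run M C F edgeMapProgram (A ∅) (A Set.univ)
      (fun _ s => ∀ i j, i < k → j < deg i → Post i j s)
      (∑ i ∈ Finset.range k, (deg i * (we + 60) + 80)) (we + 26 + 48 * h) 47 ρ s := by
  have hcard := hin.card_le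
  have hmono := partialSum_mono deg
  have hown : IsOwnership k (fun lo hi => {p : ℕ × ℕ | lo ≤ p.1 ∧ p.1 < hi}) Set.univ :=
    { subset := fun _ _ _ => Set.subset_univ _
      left := fun lo mid hi h1 h2 _ p hp => ⟨hp.1, hp.2.trans_le h2⟩
      right := fun lo mid hi h1 h2 _ p hp => ⟨h1.trans hp.1, hp.2⟩
      disjoint := fun lo mid hi h1 h2 _ => Set.disjoint_left.2 fun p hp hp' => by
        have := hp.2
        have := hp'.1
        omega }
  have hown' : ∀ i, IsOwnership (deg i) (fun lo hi => {p : ℕ × ℕ | p.1 = i ∧ lo ≤ p.2 ∧ p.2 < hi})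
      Set.univ := fun i =>
    { subset := fun _ _ _ => Set.subset_univ _
      left := fun lo mid hi h1 h2 _ p hp => ⟨hp.1, hp.2.1, hp.2.2.trans_le h2⟩
      right := fun lo mid hi h1 h2 _ p hp => ⟨hp.1, h1.trans hp.2.1, hp.2.2⟩
      disjoint := fun lo mid hi h1 h2 _ => Set.disjoint_left.2 fun p hp hp' => by
        have := hp.2.2
        have := hp'.2.1
        omega }
  -- A leaf of the outer recursion is an entire inner recursion, whose depth `24 * h` is added to
  -- that of the outer one. The `20` in the work of a leaf covers the `18` instructions that prepare
  -- the inner range and the `2` needed when that range is empty.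
  have key := Run.divideAndConquer (M := M) (C := C) (F := F) hA hown (κ := κ)
    (Pre := fun lo hi b e s => b = partialSum deg lo ∧ e = partialSum deg hi ∧
      Sums (fun i => s.small (n + 1 + i)) (partialSum deg) lo hi ∧ s.large = L ∧
      (∀ i, i < k → s.small i = ul i) ∧ ∀ i j, lo ≤ i → i < hi → j < deg i → Pre i j s)
    (Post := fun lo hi s => ∀ i j, lo ≤ i → i < hi → j < deg i → Post i j s)
    (wl := fun i => deg i * (we + 60) + 20) (dl := we + 22 + 24 * h) (by omega) (by omega) (by omega)
    ?_ ?_ ?_ ?_ h hk le_rfl (by omega) hctx h3 h4 h5 h6 (s := s)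
    ⟨rfl, rfl, hS, hL, hlist, fun i j _ h1 h2 => hpre i j h1 h2⟩
  · refine key.mono (fun x y h => hA.mono _ _ _ _ (by simp) h)
      (fun x y h => hA.mono _ _ _ _ (by simp) h)
      (fun ρ s h i j hi hj => h i j (Nat.zero_le i) hi hj) ?_ (by omega)
    rw [Finset.range_eq_Ico]
    exact (Nat.sub_le _ _).trans (Finset.sum_le_sum fun i _ => by omega)
  · rintro lo hi b e s s' h1 h2 h3 ⟨h4, h5, h6, h7, h8, h9⟩
    refine ⟨h4, h5, h6.congr fun i h10 h11 => hsmall _ _ _ h3 _ (by omega),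
      (hlarge _ _ _ h3).trans h7, fun i hi => (hsmall _ _ _ h3 _ (by omega)).trans (h8 i hi),
      fun i j h10 h11 h12 => pre_stable i j s s' (by omega) h12 (hA.mono _ _ _ _ ?_ h3)
        (h9 i j h10 h11 h12)⟩
    rintro p ⟨-, hp⟩ rfl
    exact hp ⟨h10, h11⟩
  · rintro lo mid hi b e s hm h1 h2 h3 ⟨rfl, rfl, h6, h7, h8, h9⟩
    have hsum := hin.partialSum_le
    have := h6.eval_sub hmono hm h1 h2 (w := M.wordBits)
      (lt_of_le_of_lt (hmono h3) (by omega))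
    rw [h15, this]
    obtain ⟨-, h10, h11⟩ := h6.split hm h1 h2
    exact ⟨⟨rfl, rfl, h10, h7, h8, fun i j hi1 hi2 => h9 i j hi1 (by omega)⟩,
      ⟨rfl, rfl, h11, h7, h8, fun i j hi1 hi2 => h9 i j (by omega) hi2⟩⟩
  · rintro i b e ρ s hi hctx h3 hb he ⟨rfl, rfl, -, h7, h8, h9⟩
    have hE := hA.protocol (Set.univ \ {p : ℕ × ℕ | i ≤ p.1 ∧ p.1 < i + 1})
      {p : ℕ × ℕ | i ≤ p.1 ∧ p.1 < i + 1}
    have hpre_stable : ∀ s', A (Set.univ \ {p : ℕ × ℕ | i ≤ p.1 ∧ p.1 < i + 1}) s s' →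
        ∀ j, j < deg i → Pre i j s' := by
      intro s' hs' j hj
      refine pre_stable i j s s' hi hj (hA.mono _ _ _ _ ?_ hs') (h9 i j le_rfl (by omega) hj)
      rintro p ⟨-, hp⟩ rfl
      exact hp ⟨le_rfl, Nat.lt_succ_self _⟩
    refine Run.weaken (m := deg i * (we + 60) + 2 + 18) (e := we + 4 + 24 * h + 18) ?_ le_rfl
      (by omega)
    refine Run.adjacencyList hE hin hw hs hmode hmode' h16 hi hctx h3 hb he
      (fun s' hs' => ⟨(hlarge _ _ _ hs').trans h7,
        (hsmall _ _ _ hs' _ (by omega)).trans (h8 i hi)⟩) ?_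
    intro s1 ρ1 hs1 hctx1 h31 h41
    have hdeg := hin.deg_le i hi
    -- An empty adjacency list is treated apart because `Run.divideAndConquer` needs a non-empty
    -- range.
    rcases Nat.eq_zero_or_pos (deg i) with h0 | h0
    · refine Run.weaken (m := 2) (e := 2) ?_ (by omega) (by omega)
      refine Run.jumpIfLt_false rfl hE (by omega) ?_
      refine Run.halt rfl hE fun s2 _ i' j hi1 hi2 hj => ?_
      obtain rfl : i = i' := by omega
      omega
    -- Here the descent subtracts words of the degree array that have no meaning for the inner
    -- range, so its precondition ignores both bounds.
    have inner := Run.divideAndConquer (M := M) (C := C) (F := F) hA (hown' i)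
      (κ := adjacencyCtx κ (n + 1 + L (ul i)) (partialSum deg i) (ul i))
      (Pre := fun lo hi _ _ s => s.large = L ∧ ∀ j, lo ≤ j → j < hi → Pre i j s)
      (Post := fun lo hi s => ∀ j, lo ≤ j → j < hi → Post i j s)
      (wl := fun _ => we) (dl := we) (by omega) (by simp [adjacencyCtx]; omega)
      (by simp [adjacencyCtx]; omega) ?_ ?_ ?_ ?_ h h0 le_rfl (by omega) hctx1 h31 h41 rfl rfl
      (s := s1) ⟨(hlarge _ _ _ hs1).trans h7, fun j _ hj => hpre_stable s1 hs1 j hj⟩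
    · refine inner.mono (fun x y h => hA.mono _ _ _ _ ?_ h) (fun x y h => hA.mono _ _ _ _ ?_ h)
        (fun _ s h i' j hi1 hi2 hj => ?_) ?_ (by omega)
      · rintro p ⟨-, hp⟩
        refine ⟨trivial, fun hp' => hp ?_⟩
        have := hp'.1
        simp
        omega
      · rintro p hp
        have := hp.1
        simp
        omega
      · obtain rfl : i = i' := by omega
        exact h j (Nat.zero_le j) hj
      · simp
        omega
    · rintro lo hi' b e s s' h1 h2 h3 ⟨h4, h5⟩
      refine ⟨(hlarge _ _ _ h3).trans h4, fun j h6 h7 => pre_stable i j s s' hi (by omega)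
        (hA.mono _ _ _ _ ?_ h3) (h5 j h6 h7)⟩
      rintro p ⟨-, hp⟩ rfl
      exact hp ⟨rfl, h6, h7⟩
    · rintro lo mid hi' b e s hm h1 h2 h3 ⟨h4, h5⟩
      exact ⟨⟨h4, fun j hj1 hj2 => h5 j hj1 (by omega)⟩, h4, fun j hj1 hj2 => h5 j (by omega) hj2⟩
    · rintro j b e ρ s hj hctx h3 _ _ ⟨h4, h5⟩
      refine (edge i j ρ s hi hj hctx h3 h4 (h5 j le_rfl (by omega))).mono
        (fun x y h => hA.mono _ _ _ _ ?_ h) (fun x y h => hA.mono _ _ _ _ ?_ h)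
        (fun _ s h j' hj1 hj2 => ?_) le_rfl le_rfl
      · rintro ⟨p1, p2⟩ ⟨-, hp⟩ hp'
        obtain ⟨rfl, rfl⟩ := Prod.mk.inj hp'
        exact hp ⟨rfl, le_rfl, Nat.lt_succ_self _⟩
      · rintro p rfl
        exact ⟨rfl, le_rfl, Nat.lt_succ_self _⟩
      · obtain rfl : j = j' := by omega
        exact h
    · intro lo mid hi' ρ s _ h1 h2 hH hctx _ _ hp1 hp2
      refine Run.combine_nothing (hA.protocol _ _) hctx (by simp [adjacencyCtx]; omega)
        fun s' hs' j hj1 hj2 => post_stable i j s s' hi (by omega) (hA.mono _ _ _ _ ?_ hs') ?_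
      · rintro p ⟨-, hp⟩ rfl
        exact hp ⟨rfl, hj1, hj2⟩
      · rcases lt_or_ge j mid with h | h
        · exact hp1 j hj1 h
        · exact hp2 j h hj2
  · intro lo mid hi ρ s _ h1 h2 hH hctx _ _ hp1 hp2
    refine Run.combine_nothing (hA.protocol _ _) hctx (by omega)
      fun s' hs' i j hi1 hi2 hj => post_stable i j s s' (by omega) hj (hA.mono _ _ _ _ ?_ hs') ?_
    · rintro p ⟨-, hp⟩ rfl
      exact hp ⟨hi1, hi2⟩
    · rcases lt_or_ge i mid with h | h
      · exact hp1 i j hi1 h hj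
      · exact hp2 i j h hi2 hj

end Edges

/-! ### Choosing distinct slots for the targets of edges -/

/-- The possible slots of a vertex `v`: if there are fewer than `n` edges, the slots are the numbers
of the edges to `v`, otherwise `v` is its own slot. -/
def IsSlot (n k : ℕ) (L ul deg : ℕ → ℕ) (v x : ℕ) : Prop :=
  if partialSum deg k < n then
    ∃ i j, i < k ∧ j < deg i ∧ adjacent n L ul i j = v ∧ x = partialSum deg i + j
  else x = v

/-- Both kinds of slots fit: edge numbers are below the sum of the degrees, which is used only when
it is less than `n`, and vertices are below `n`. -/
theorem IsSlot.lt {n k : ℕ} {L ul deg : ℕ → ℕ} {v x : ℕ} (h : IsSlot n k L ul deg v x)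
    (hv : v < n) : x < min (partialSum deg k) n := by
  unfold IsSlot at h
  split_ifs at h with hD
  · obtain ⟨i, j, hi, hj, -, rfl⟩ := h
    have := partialSum_mono deg (Nat.succ_le_of_lt hi)
    rw [Nat.succ_eq_add_one, partialSum_succ] at this
    omega
  · omega

/-- Edge numbers of different list elements fall into disjoint blocks between consecutive prefix
sums, so a number determines its edge and hence the target. -/
theorem IsSlot.injective {n k : ℕ} {L ul deg : ℕ → ℕ} {v v' x : ℕ}
    (h : IsSlot n k L ul deg v x) (h' : IsSlot n k L ul deg v' x) : v = v' := by
  unfold IsSlot at h h'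
  split_ifs at h h' with hD
  · obtain ⟨i, j, hi, hj, rfl, rfl⟩ := h
    obtain ⟨i', j', hi', hj', rfl, hx⟩ := h'
    have key : ∀ a b c d, c < deg a → partialSum deg a + c = partialSum deg b + d → ¬ a < b := by
      intro a b c d hc h hab
      have := partialSum_mono deg (Nat.succ_le_of_lt hab)
      rw [Nat.succ_eq_add_one, partialSum_succ] at this
      omega
    have h1 := key i i' j j' hj hx
    have h2 := key i' i j' j hj' hx.symm
    obtain rfl : i = i' := by omega
    obtain rfl : j = j' := by omega
    rfl
  · exact h.symm.trans h'

section Slots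

variable {n : ℕ} {σ : Type u} {M : Machine} {C : Fin n → σ → Bool}
  {F : Fin n → Fin n → σ → Bool × σ}

/-- Changes of the slots of vertices to possible ones. -/
structure SlotAction (valid : ℕ → ℕ → Prop) (_ : Set (ℕ × ℕ)) (s s' : Shared n σ) : Prop where
  large : s'.large = s.large
  user : s'.user = s.user
  calls : s'.calls = s.calls
  small : ∀ a, a < 3 * (n + 1) ∨ 4 * (n + 1) ≤ a → s'.small a = s.small a
  slot : ∀ v, v < n → s'.small (3 * (n + 1) + v) = s.small (3 * (n + 1) + v) ∨
    valid v (s'.small (3 * (n + 1) + v))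

/-- The set of owners plays no role: all threads may race for the slot of a common target. Validity
does not depend on the state, so any number of overwrites leaves a valid slot. -/
theorem isAction_slotAction (valid : ℕ → ℕ → Prop) :
    IsAction (SlotAction (n := n) (σ := σ) valid) where
  refl _ _ := ⟨rfl, rfl, rfl, fun _ _ => rfl, fun _ _ => .inl rfl⟩
  trans _ _ _ _ h h' := ⟨h'.large.trans h.large, h'.user.trans h.user, h'.calls.trans h.calls,
    fun a ha => (h'.small a ha).trans (h.small a ha), fun v hv => by
      rcases h'.slot v hv with e | e
      · rw [e]
        exact h.slot v hv
      · exact .inr e⟩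
  mono _ _ _ _ _ h := ⟨h.large, h.user, h.calls, h.small, h.slot⟩

theorem SlotAction.store {valid : ℕ → ℕ → Prop} {X : Set (ℕ × ℕ)} (s : Shared n σ) {v x : ℕ}
    (hv : v < n) (hx : valid v x) : SlotAction valid X s
      { s with small := Function.update s.small (3 * (n + 1) + v) x } := by
  refine ⟨rfl, rfl, rfl, fun b hb => Function.update_of_ne (by omega) _ _, fun v' _ => ?_⟩
  by_cases h : v' = v
  · subst h
    right
    simpa using hx
  · exact .inl (Function.update_of_ne (by omega) _ _)

/-- Modes `6` and `4`. -/
theorem Run.slots {k : ℕ} {L ul deg κ : ℕ → ℕ}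
    (hin : IsVertexList n k L ul deg) (hw : 2 * (n * n) + 8 * (n + 1) < 2 ^ M.wordBits)
    (hs : 6 * (n + 1) ≤ M.smallWords) (h14 : κ 14 = 6) (h10 : κ 10 = n)
    (h15 : κ 15 = n + 1) (h16 : κ 16 = n + 1) (h18 : κ 18 = 3 * (n + 1))
    (h21 : κ 21 = partialSum deg k)
    {h : ℕ} (hk : 0 < k) (hh : n ≤ 2 ^ h) {ρ : ℕ → ℕ} {s : Shared n σ} (hctx : Ctx κ ρ)
    (h3 : ρ 3 = 0) (h4 : ρ 4 = k) (h5 : ρ 5 = 0) (h6 : ρ 6 = partialSum deg k)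
    (hL : s.large = L) (hlist : ∀ i, i < k → s.small i = ul i)
    (hS : Sums (fun i => s.small (n + 1 + i)) (partialSum deg) 0 k) :
    Run M C F edgeMapProgram (SlotAction (IsSlot n k L ul deg) ∅)
      (SlotAction (IsSlot n k L ul deg) Set.univ)
      (fun _ s => ∀ i j, i < k → j < deg i → IsSlot n k L ul deg (adjacent n L ul i j)
        (s.small (3 * (n + 1) + adjacent n L ul i j)))
      (∑ i ∈ Finset.range k, (deg i * (15 + 60) + 80)) (15 + 26 + 48 * h) 47 ρ s := by
  have hA := isAction_slotAction (n := n) (σ := σ) (IsSlot n k L ul deg)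
  refine Run.forEdges hA hin hw hs (by omega) (by omega) h15 h16 (fun _ _ _ h => h.large)
    (fun _ _ _ h a ha => h.small a (by omega)) (Pre := fun _ _ _ => True)
    (Post := fun i j s => IsSlot n k L ul deg (adjacent n L ul i j)
        (s.small (3 * (n + 1) + adjacent n L ul i j)))
    (fun _ _ _ _ _ _ _ _ => trivial) ?_ ?_ hk hh hctx h3 h4 h5 h6 hL hlist hS
    (fun _ _ _ _ => trivial)
  -- Another edge may have replaced the slot, but only by another possible one.
  · intro i j s s' hi hj hs' hp
    rcases hs'.slot _ (hin.adjacent_lt i j hi hj) with e | e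
    · rwa [e]
    · exact e
  · intro i j ρ s hi hj hctx h3 hL _
    have hE := hA.protocol {(i, j)}ᶜ {(i, j)}
    have r11 := (hctx.eq 11 (by norm_num)).trans hctx.zero
    have r12 := (hctx.eq 12 (by norm_num)).trans hctx.one
    have r13 := (hctx.eq 13 (by norm_num)).trans hctx.two
    have r14 : ρ 14 = 4 := (hctx.eq 14 (by norm_num)).trans (by simp [adjacencyCtx, h14])
    have r10 : ρ 10 = n := (hctx.eq 10 (by norm_num)).trans (by simp [adjacencyCtx, h10])
    have r18 : ρ 18 = 3 * (n + 1) := (hctx.eq 18 (by norm_num)).trans (by simp [adjacencyCtx, h18])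
    have r21 : ρ 21 = partialSum deg k :=
      (hctx.eq 21 (by norm_num)).trans (by simp [adjacencyCtx, h21])
    have r24 : ρ 24 = n + 1 + L (ul i) := (hctx.eq 24 (by norm_num)).trans (by simp [adjacencyCtx])
    have r25 : ρ 25 = partialSum deg i := (hctx.eq 25 (by norm_num)).trans (by simp [adjacencyCtx])
    have hadj := hin.adjacent_lt i j hi hj
    have hos := hin.offset_succ i hi
    have hol := hin.offset_le i hi
    have hsum := hin.partialSum_le
    have hmono := partialSum_mono deg (Nat.succ_le_of_lt hi)
    rw [Nat.succ_eq_add_one, partialSum_succ] at hmono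
    refine Run.jumpIfLt_false rfl hE (by omega) ?_
    refine Run.jumpIfLt_false rfl hE (by omega) ?_
    refine Run.const rfl hE (by omega) ?_
    refine Run.jumpIfLt_false rfl hE (by simp [r14]) ?_
    refine Run.const rfl hE (by omega) ?_
    refine Run.jumpIfLt_false rfl hE (by simp [r14]) ?_
    refine Run.const rfl hE (by omega) ?_
    refine Run.jumpIfLt_true rfl hE (by simp [r14]) ?_
    refine Run.add (n + 1 + L (ul i)) j rfl hE (by simp [r24]) (by simp [h3]) (by omega) ?_
    refine Run.loadLarge rfl hE fun s1 hs1 => ?_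
    rw [Function.update_self, hs1.large, hL]
    change Run _ _ _ _ _ _ _ _ _ _ (Function.update _ 8 (adjacent n L ul i j)) _
    refine Run.add (3 * (n + 1)) (adjacent n L ul i j) rfl hE (by simp [r18]) (by simp)
      (by omega) ?_
    by_cases hD : partialSum deg k < n
    · have hv : IsSlot n k L ul deg (adjacent n L ul i j) (partialSum deg i + j) := by
        rw [IsSlot, if_pos hD]
        exact ⟨i, j, hi, hj, rfl, rfl⟩
      refine Run.jumpIfLt_true rfl hE (by simpa [r21, r10] using hD) ?_
      refine Run.add (partialSum deg i) j rfl hE (by simp [r25]) (by simp [h3]) (by omega) ?_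
      refine Run.storeSmall rfl (by simp; omega) fun s2 hs2 => ⟨?_, ?_⟩
      · simpa using SlotAction.store s2 hadj hv
      · refine Run.halt rfl hE fun s3 hs3 => ?_
        rcases hs3.slot _ hadj with e | e
        · rw [e]
          simpa using hv
        · exact e
    · have hv : IsSlot n k L ul deg (adjacent n L ul i j) (adjacent n L ul i j) := by
        rw [IsSlot, if_neg hD]
      refine Run.jumpIfLt_false rfl hE (by simpa [r21, r10] using hD) ?_
      refine Run.weaken (m := 2) (e := 2) ?_ (by norm_num) (by norm_num)
      refine Run.storeSmall rfl (by simp; omega) fun s2 hs2 => ⟨?_, ?_⟩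
      · simpa using SlotAction.store s2 hadj hv
      · refine Run.halt rfl hE fun s3 hs3 => ?_
        rcases hs3.slot _ hadj with e | e
        · rw [e]
          simpa using hv
        · exact e

end Slots

/-! ### Application of the user functions -/

section Calls

variable {n : ℕ}

/-- Each application is preceded by a successful evaluation of the condition. -/
def Guarded (calls : List (Call n)) : Prop :=
  ∀ u v b before after, calls = before ++ .apply u v b :: after → .condition v true ∈ before

theorem Guarded.append {calls : List (Call n)} (h : Guarded calls) {c : Call n}
    (hc : ∀ u v b, c = .apply u v b → .condition v true ∈ calls) : Guarded (calls ++ [c]) := by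
  intro u v b before after heq
  rcases List.eq_nil_or_concat after with rfl | ⟨after', c', rfl⟩
  · obtain ⟨rfl, h'⟩ := List.append_inj' heq rfl
    exact hc u v b (List.head_eq_of_cons_eq h')
  · rw [List.concat_eq_append, ← List.cons_append, ← List.append_assoc] at heq
    exact h u v b before after' (List.append_inj' heq rfl).1

open Classical in
/-- No pair has more than one application. -/
def AppliedOnce (calls : List (Call n)) : Prop :=
  ∀ u v, calls.countP (fun c => decide (c.IsApply u v)) ≤ 1

theorem AppliedOnce.append {calls : List (Call n)} (h : AppliedOnce calls) {c : Call n}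
    (hc : ∀ u v b, c = .apply u v b → ∀ b', .apply u v b' ∉ calls) :
    AppliedOnce (calls ++ [c]) := by
  classical
  intro u v
  rw [List.countP_append]
  by_cases hcu : c.IsApply u v
  · obtain ⟨b, rfl⟩ := hcu
    have : calls.countP (fun c => decide (c.IsApply u v)) = 0 := by
      rw [List.countP_eq_zero]
      rintro c' hc' hca
      obtain ⟨b', rfl⟩ := of_decide_eq_true hca
      exact hc u v b rfl b' hc'
    rw [this, zero_add]
    exact List.countP_le_length
  · have : [c].countP (fun c => decide (c.IsApply u v)) = 0 := by
      simp [hcu]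
    rw [this, add_zero]
    exact h u v

end Calls

section Applications

variable {n : ℕ} {σ : Type u} {M : Machine} {C : Fin n → σ → Bool}
  {F : Fin n → Fin n → σ → Bool × σ}

/-- The state during the application of `F` to the edges: the slots in use hold the targets of
successful applications. -/
structure ApplyInvariant (k : ℕ) (L ul deg slot : ℕ → ℕ) (N : ℕ) (s : Shared n σ) : Prop where
  sound : ∀ (u v : Fin n) b, .apply u v b ∈ s.calls →
    ∃ i j, i < k ∧ j < deg i ∧ (u : ℕ) = ul i ∧ (v : ℕ) = adjacent n L ul i j
  once : AppliedOnce s.calls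
  guarded : Guarded s.calls
  slots : ∀ i, i < N → s.small (2 * (n + 1) + i) = 0 ∨ (s.small (2 * (n + 1) + i) = 1 ∧
    ∃ u v : Fin n, .apply u v true ∈ s.calls ∧ slot v = i ∧ s.small (4 * (n + 1) + i) = v)

/-- What the threads for the edges with numbers in `X` do. -/
structure ApplyAction (k : ℕ) (L ul deg slot : ℕ → ℕ) (N : ℕ) (X : Set (ℕ × ℕ))
    (s s' : Shared n σ) : Prop where
  large : s'.large = s.large
  small : ∀ a, a < 2 * (n + 1) ∨ 2 * (n + 1) + N ≤ a ∧ a < 4 * (n + 1) → s'.small a = s.small a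
  calls : ∃ l, s'.calls = s.calls ++ l ∧ ∀ (u v : Fin n) b, .apply u v b ∈ l → ∃ i j, (i, j) ∈ X ∧
    i < k ∧ j < deg i ∧ (u : ℕ) = ul i ∧ (v : ℕ) = adjacent n L ul i j
  flag : ∀ i, i < N → s.small (2 * (n + 1) + i) = 1 → s'.small (2 * (n + 1) + i) = 1
  vertex : ∀ i j, i < k → j < deg i →
    s.small (4 * (n + 1) + slot (adjacent n L ul i j)) = adjacent n L ul i j →
    s'.small (4 * (n + 1) + slot (adjacent n L ul i j)) = adjacent n L ul i j
  invariant : ApplyInvariant k L ul deg slot N s → ApplyInvariant k L ul deg slot N s'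

/-- The invariant enters an action as an implication from the old to the new state. Thus each thread
only shows that its own steps preserve it, and it needs to be known only for the state before all
applications. -/
theorem isAction_applyAction (k : ℕ) (L ul deg slot : ℕ → ℕ) (N : ℕ) :
    IsAction (ApplyAction (n := n) (σ := σ) k L ul deg slot N) where
  refl _ _ := ⟨rfl, fun _ _ => rfl, ⟨[], by simp⟩, fun _ _ => id, fun _ _ _ _ => id, id⟩
  trans X a b c h h' := by
    refine ⟨h'.large.trans h.large, fun a ha => (h'.small a ha).trans (h.small a ha), ?_,
      fun i hi h0 => h'.flag i hi (h.flag i hi h0),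
      fun i j hi hj h0 => h'.vertex i j hi hj (h.vertex i j hi hj h0),
      fun h0 => h'.invariant (h.invariant h0)⟩
    obtain ⟨l, e, hl⟩ := h.calls
    obtain ⟨l', e', hl'⟩ := h'.calls
    refine ⟨l ++ l', by rw [e', e, List.append_assoc], fun u v b hm => ?_⟩
    rcases List.mem_append.1 hm with hm | hm
    · exact hl u v b hm
    · exact hl' u v b hm
  mono X Y a b hX h := by
    refine ⟨h.large, h.small, ?_, h.flag, h.vertex, h.invariant⟩
    obtain ⟨l, e, hl⟩ := h.calls
    refine ⟨l, e, fun u v b hm => ?_⟩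
    obtain ⟨i, j, h1, h2⟩ := hl u v b hm
    exact ⟨i, j, hX h1, h2⟩

theorem ApplyAction.mem_calls {k : ℕ} {L ul deg slot : ℕ → ℕ} {N : ℕ} {X : Set (ℕ × ℕ)}
    {s s' : Shared n σ} (h : ApplyAction k L ul deg slot N X s s') {c : Call n}
    (hc : c ∈ s.calls) : c ∈ s'.calls := by
  obtain ⟨l, e, -⟩ := h.calls
  rw [e]
  exact List.mem_append_left _ hc

/-- Neither the list nor an adjacency list has repetitions, so a pair `(u, v)` belongs to one index
pair only. This gives at most one application per edge without any synchronization. -/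
theorem ApplyAction.not_mem_calls {k : ℕ} {L ul deg slot : ℕ → ℕ} {N : ℕ}
    (hin : IsVertexList n k L ul deg) {i j : ℕ} (hi : i < k) (hj : j < deg i)
    {s s' : Shared n σ} (h : ApplyAction k L ul deg slot N {(i, j)}ᶜ s s') {u v : Fin n} {b : Bool}
    (hu : (u : ℕ) = ul i) (hv : (v : ℕ) = adjacent n L ul i j) (hc : .apply u v b ∉ s.calls) :
    .apply u v b ∉ s'.calls := by
  obtain ⟨l, e, hl⟩ := h.calls
  rw [e]
  intro hm
  rcases List.mem_append.1 hm with hm | hm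
  · exact hc hm
  · obtain ⟨i', j', h1, h2, h3, h4, h5⟩ := hl u v b hm
    obtain rfl := hin.injective i' i h2 hi (h4.symm.trans hu)
    obtain rfl := hin.adjacent_injective i' j' j h2 h3 hj (h5.symm.trans hv)
    exact h1 rfl

/-- A slot belongs to one target, so a repeated write to its cell stores the value that is already
there, and neither other targets nor flagged slots are damaged. -/
theorem ApplyAction.storeVertex {k N : ℕ} {L ul deg slot : ℕ → ℕ} {X : Set (ℕ × ℕ)}
    (s : Shared n σ) (hN : N ≤ n)
    (hslot : ∀ i j, i < k → j < deg i → slot (adjacent n L ul i j) < N)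
    (hslot_inj : ∀ i j i' j', i < k → j < deg i → i' < k → j' < deg i' →
      slot (adjacent n L ul i j) = slot (adjacent n L ul i' j') →
      adjacent n L ul i j = adjacent n L ul i' j') {i j : ℕ} (hi : i < k) (hj : j < deg i) {v : Fin n}
    (hv : (v : ℕ) = adjacent n L ul i j) :
    ApplyAction k L ul deg slot N X s
      { s with small := Function.update s.small (4 * (n + 1) + slot v) v } := by
  have hsl := hslot i j hi hj
  rw [← hv] at hsl
  refine ⟨rfl, fun a ha => Function.update_of_ne (by omega) _ _, ⟨[], by simp⟩,
    fun i' hi' h0 => ?_, fun i' j' hi' hj' h0 => ?_, fun hI => ⟨hI.sound, hI.once,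
      hI.guarded, fun i' hi' => ?_⟩⟩ <;> dsimp only at *
  · rwa [Function.update_of_ne (by omega)]
  · by_cases h1 : slot (adjacent n L ul i' j') = slot v
    · rw [h1, Function.update_self, hv]
      exact (hslot_inj i' j' i j hi' hj' hi hj (by rw [h1, hv])).symm
    · rwa [Function.update_of_ne (by omega)]
  · rw [Function.update_of_ne (by omega)]
    rcases hI.slots i' hi' with h0 | ⟨h1, u', v', h2, h3, h4⟩
    · exact .inl h0
    · refine .inr ⟨h1, u', v', h2, h3, ?_⟩
      by_cases h5 : i' = slot v
      · obtain ⟨i₁, j₁, h6, h7, -, h8⟩ := hI.sound u' v' true h2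
        rw [h5, Function.update_self, hv, h8]
        exact (hslot_inj i₁ j₁ i j h6 h7 hi hj (by rw [← h8, ← hv, h3, h5])).symm
      · rwa [Function.update_of_ne (by omega)]

/-- The flag comes after the vertex: a flagged slot must already hold a successful target when other
threads can see it. -/
theorem ApplyAction.storeFlag {k N : ℕ} {L ul deg slot : ℕ → ℕ} {X : Set (ℕ × ℕ)}
    (s : Shared n σ) (hN : N ≤ n)
    (hslot : ∀ i j, i < k → j < deg i → slot (adjacent n L ul i j) < N) {u v : Fin n}
    (hsl : slot v < N) (hm : .apply u v true ∈ s.calls)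
    (hvert : s.small (4 * (n + 1) + slot v) = v) :
    ApplyAction k L ul deg slot N X s
      { s with small := Function.update s.small (2 * (n + 1) + slot v) 1 } := by
  refine ⟨rfl, fun a ha => Function.update_of_ne (by omega) _ _, ⟨[], by simp⟩,
    fun i' hi' h0 => ?_, fun i' j' hi' hj' h0 => ?_, fun hI => ⟨hI.sound, hI.once,
      hI.guarded, fun i' hi' => ?_⟩⟩ <;> dsimp only at *
  · by_cases h1 : i' = slot v
    · rw [h1, Function.update_self]
    · rwa [Function.update_of_ne (by omega)]
  · have := hslot i' j' hi' hj'
    rwa [Function.update_of_ne (by omega)]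
  · rw [Function.update_of_ne (a := 4 * (n + 1) + i') (by omega)]
    by_cases h1 : i' = slot v
    · subst h1
      exact .inr ⟨Function.update_self .., u, v, hm, rfl, hvert⟩
    · rw [Function.update_of_ne (by omega)]
      exact hI.slots i' hi'

/-- Modes `7` and `5`. -/
theorem Run.applications {k N : ℕ} {L ul deg slot κ : ℕ → ℕ}
    (hin : IsVertexList n k L ul deg) (hw : 2 * (n * n) + 8 * (n + 1) < 2 ^ M.wordBits)
    (hs : 6 * (n + 1) ≤ M.smallWords) (hN : N ≤ n)
    (hslot : ∀ i j, i < k → j < deg i → slot (adjacent n L ul i j) < N)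
    (hslot_inj : ∀ i j i' j', i < k → j < deg i → i' < k → j' < deg i' →
      slot (adjacent n L ul i j) = slot (adjacent n L ul i' j') →
      adjacent n L ul i j = adjacent n L ul i' j')
    (h14 : κ 14 = 7) (h15 : κ 15 = n + 1) (h16 : κ 16 = n + 1) (h17 : κ 17 = 2 * (n + 1))
    (h18 : κ 18 = 3 * (n + 1)) (h19 : κ 19 = 4 * (n + 1))
    {h : ℕ} (hk : 0 < k) (hh : n ≤ 2 ^ h) {ρ : ℕ → ℕ} {s : Shared n σ} (hctx : Ctx κ ρ)
    (h3 : ρ 3 = 0) (h4 : ρ 4 = k) (h5 : ρ 5 = 0) (h6 : ρ 6 = partialSum deg k)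
    (hL : s.large = L) (hlist : ∀ i, i < k → s.small i = ul i)
    (hS : Sums (fun i => s.small (n + 1 + i)) (partialSum deg) 0 k)
    (hcalls : s.calls = []) (hslots : ∀ v, v < n → s.small (3 * (n + 1) + v) = slot v) :
    Run M C F edgeMapProgram (ApplyAction k L ul deg slot N ∅)
      (ApplyAction k L ul deg slot N Set.univ)
      (fun _ s => ∀ i j, i < k → j < deg i → ∃ u v : Fin n, (u : ℕ) = ul i ∧
        (v : ℕ) = adjacent n L ul i j ∧
        ((∃ b, .apply u v b ∈ s.calls) ∨ .condition v false ∈ s.calls) ∧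
        (.apply u v true ∈ s.calls → s.small (2 * (n + 1) + slot v) = 1))
      (∑ i ∈ Finset.range k, (deg i * (23 + 60) + 80)) (23 + 26 + 48 * h) 47 ρ s := by
  have hA := isAction_applyAction (n := n) (σ := σ) k L ul deg slot N
  refine Run.forEdges hA hin hw hs (by omega) (by omega) h15 h16 (fun _ _ _ h => h.large)
    (fun _ _ _ h a ha => h.small a (by omega))
    (Pre := fun i j s => (∀ (u v : Fin n) (b : Bool), (u : ℕ) = ul i →
      (v : ℕ) = adjacent n L ul i j → .apply u v b ∉ s.calls) ∧
      ∀ v, v < n → s.small (3 * (n + 1) + v) = slot v)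
    (Post := fun i j s => ∃ u v : Fin n, (u : ℕ) = ul i ∧
        (v : ℕ) = adjacent n L ul i j ∧
        ((∃ b, .apply u v b ∈ s.calls) ∨ .condition v false ∈ s.calls) ∧
        (.apply u v true ∈ s.calls → s.small (2 * (n + 1) + slot v) = 1))
    ?_ ?_ ?_ hk hh hctx h3 h4 h5 h6 hL hlist hS
    (fun _ _ _ _ => ⟨by simp [hcalls], hslots⟩)
  · rintro i j s s' hi hj hs' ⟨h1, h2⟩
    exact ⟨fun u v b hu hv => hs'.not_mem_calls hin hi hj hu hv (h1 u v b hu hv),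
      fun v hv => (hs'.small _ (by omega)).trans (h2 v hv)⟩
  · rintro i j s s' hi hj hs' ⟨u, v, hu, hv, h1, h2⟩
    refine ⟨u, v, hu, hv, ?_, fun h3 => ?_⟩
    · rcases h1 with ⟨b, h1⟩ | h1
      · exact .inl ⟨b, hs'.mem_calls h1⟩
      · exact .inr (hs'.mem_calls h1)
    -- Other threads do not apply `F` to this pair, so a successful application was already recorded
    -- before the environment acted, and flags are never cleared.
    · by_cases h4 : .apply u v true ∈ s.calls
      · exact hs'.flag _ (by rw [hv]; exact hslot i j hi hj) (h2 h4)
      · exact absurd h3 (hs'.not_mem_calls hin hi hj hu hv h4)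
  · rintro i j ρ s hi hj hctx h3 hL ⟨hp1, hp2⟩
    have hE := hA.protocol {(i, j)}ᶜ {(i, j)}
    have r11 := (hctx.eq 11 (by norm_num)).trans hctx.zero
    have r12 := (hctx.eq 12 (by norm_num)).trans hctx.one
    have r13 := (hctx.eq 13 (by norm_num)).trans hctx.two
    have r14 : ρ 14 = 5 := (hctx.eq 14 (by norm_num)).trans (by simp [adjacencyCtx, h14])
    have r17 : ρ 17 = 2 * (n + 1) := (hctx.eq 17 (by norm_num)).trans (by simp [adjacencyCtx, h17])
    have r18 : ρ 18 = 3 * (n + 1) := (hctx.eq 18 (by norm_num)).trans (by simp [adjacencyCtx, h18])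
    have r19 : ρ 19 = 4 * (n + 1) := (hctx.eq 19 (by norm_num)).trans (by simp [adjacencyCtx, h19])
    have r24 : ρ 24 = n + 1 + L (ul i) := (hctx.eq 24 (by norm_num)).trans (by simp [adjacencyCtx])
    have r26 : ρ 26 = ul i := (hctx.eq 26 (by norm_num)).trans (by simp [adjacencyCtx])
    have hadj := hin.adjacent_lt i j hi hj
    have hos := hin.offset_succ i hi
    have hol := hin.offset_le i hi
    have hsl := hslot i j hi hj
    obtain ⟨u, hu⟩ : ∃ u : Fin n, (u : ℕ) = ul i := ⟨⟨_, hin.lt i hi⟩, rfl⟩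
    obtain ⟨v, hv⟩ : ∃ v : Fin n, (v : ℕ) = adjacent n L ul i j := ⟨⟨_, hadj⟩, rfl⟩
    rw [← hv] at hadj hsl
    refine Run.jumpIfLt_false rfl hE (by omega) ?_
    refine Run.jumpIfLt_false rfl hE (by omega) ?_
    refine Run.const rfl hE (by omega) ?_
    refine Run.jumpIfLt_false rfl hE (by simp [r14]) ?_
    refine Run.const rfl hE (by omega) ?_
    refine Run.jumpIfLt_false rfl hE (by simp [r14]) ?_
    refine Run.const rfl hE (by omega) ?_
    refine Run.jumpIfLt_false rfl hE (by simp [r14]) ?_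
    refine Run.const rfl hE (by omega) ?_
    refine Run.jumpIfLt_true rfl hE (by simp [r14]) ?_
    refine Run.add (n + 1 + L (ul i)) j rfl hE (by simp [r24]) (by simp [h3]) (by omega) ?_
    refine Run.loadLarge rfl hE fun s1 hs1 => ?_
    rw [Function.update_self, hs1.large, hL]
    change Run _ _ _ _ _ _ _ _ _ _ (Function.update _ 8 (adjacent n L ul i j)) _
    rw [← hv]
    refine Run.callC rfl v (by simp) fun s2 hs2 => ?_
    have hs12 := hE.rely_trans _ _ _ hs1 hs2
    -- Other threads may change the user's data at any time, so nothing but the Boolean outcome is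
    -- kept.
    generalize C v s2.user = c
    have not_mem : ∀ b, .apply u v b ∉ s2.calls := fun b =>
      hs12.not_mem_calls hin hi hj hu hv (hp1 u v b hu hv)
    refine ⟨⟨rfl, fun _ _ => rfl, ⟨_, rfl, by simp⟩, fun _ _ => id, fun _ _ _ _ => id,
      fun hI => ⟨fun u v b hm => hI.sound u v b (by simpa using hm), hI.once.append (by simp),
        hI.guarded.append (by simp), fun i hi => ?_⟩⟩, ?_⟩
    · simpa using hI.slots i hi
    cases c with
    | false =>
      refine Run.jumpIfLt_false rfl hE (by simp) ?_
      refine Run.weaken (m := 1) (e := 1) ?_ (by norm_num) (by norm_num)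
      refine Run.halt rfl hE fun s3 hs3 => ⟨u, v, hu, rfl, .inr (hs3.mem_calls (by simp)), ?_⟩
      exact fun h => absurd h (hs3.not_mem_calls hin hi hj hu hv (by simpa using not_mem true))
    | true =>
      refine Run.jumpIfLt_true rfl hE (by simp [r11]) ?_
      refine Run.callF rfl u v (by simp [r26, hu]) (by simp) fun s3 hs3 => ?_
      generalize F u v s3.user = f
      replace not_mem : ∀ b, .apply u v b ∉ s3.calls := fun b =>
        hs3.not_mem_calls hin hi hj hu hv (by simpa using not_mem b)
      have hcond : .condition v true ∈ s3.calls := hs3.mem_calls (by simp)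
      have hsl3 : s3.small (3 * (n + 1) + v) = slot v := by
        rw [hs3.small _ (by omega), hs12.small _ (by omega), hp2 _ hadj]
      refine ⟨⟨rfl, fun _ _ => rfl, ⟨_, rfl, ?_⟩, fun _ _ => id, fun _ _ _ _ => id,
        fun hI => ⟨fun u' v' b hm => ?_, hI.once.append ?_, hI.guarded.append ?_,
          fun i hi => ?_⟩⟩, ?_⟩
      · rintro u' v' b hm
        obtain ⟨rfl, rfl, -⟩ : u' = u ∧ v' = v ∧ b = f.1 := by simpa using hm
        exact ⟨i, j, rfl, hi, hj, hu, hv⟩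
      · rcases List.mem_append.1 hm with hm | hm
        · exact hI.sound u' v' b hm
        · obtain ⟨rfl, rfl, -⟩ : u' = u ∧ v' = v ∧ b = f.1 := by simpa using hm
          exact ⟨i, j, hi, hj, hu, hv⟩
      · rintro _ _ _ ⟨⟩
        exact not_mem
      · rintro _ _ _ ⟨⟩
        exact hcond
      · rcases hI.slots i hi with h0 | ⟨h1, u', v', h2, h3⟩
        · exact .inl h0
        · exact .inr ⟨h1, u', v', List.mem_append_left _ h2, h3⟩
      clear hcond
      obtain ⟨f, fs⟩ := f
      cases f with
      | false =>
        refine Run.jumpIfLt_false rfl hE (by simp) ?_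
        refine Run.weaken (m := 1) (e := 1) ?_ (by norm_num) (by norm_num)
        refine Run.halt rfl hE fun s4 hs4 => ⟨u, v, hu, rfl,
          .inl ⟨false, hs4.mem_calls (by simp)⟩, fun h => absurd h ?_⟩
        exact hs4.not_mem_calls hin hi hj hu hv (by simpa using not_mem true)
      | true =>
        refine Run.jumpIfLt_true rfl hE (by simp [r11]) ?_
        refine Run.add (3 * (n + 1)) v rfl hE (by simp [r18]) (by simp) (by omega) ?_
        refine Run.loadSmall rfl hE (by simp; omega) fun s4 hs4 => ?_
        rw [Function.update_self, hs4.small _ (by omega), hsl3]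
        refine Run.add (4 * (n + 1)) (slot v) rfl hE (by simp [r19]) (by simp) (by omega) ?_
        refine Run.storeSmall rfl (by simp; omega) fun s5 hs5 => ⟨?_, ?_⟩
        · simpa using ApplyAction.storeVertex s5 hN hslot hslot_inj hi hj hv
        refine Run.add (2 * (n + 1)) (slot v) rfl hE (by simp [r17]) (by simp) (by omega) ?_
        refine Run.storeSmall rfl (by simp; omega) fun s6 hs6 => ⟨?_, ?_⟩
        -- Between the two writes, other threads may have written this cell, but a correct entry
        -- stays correct.
        · have hA6 : s6.small (4 * (n + 1) + slot v) = v := by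
            rw [hv]
            refine hs6.vertex i j hi hj ?_
            simp [hv]
          have hm6 : .apply u v true ∈ s6.calls :=
            hs6.mem_calls (hs5.mem_calls (hs4.mem_calls (by simp)))
          simpa [r12] using ApplyAction.storeFlag s6 hN hslot hsl hm6 hA6
        · refine Run.halt rfl hE fun s7 hs7 => ⟨u, v, hu, rfl, .inl ⟨true, ?_⟩, fun _ => ?_⟩
          · exact hs7.mem_calls (hs6.mem_calls (hs5.mem_calls (hs4.mem_calls (by simp))))
          · refine hs7.flag _ hsl ?_
            simp [r12]

end Applications

/-! ### Packing -/

/-- A discrete intermediate value argument: partial sums grow by at most `1`, so each value below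
the total is left at some index with a positive entry. -/
theorem exists_partialSum_eq {val : ℕ → ℕ} {N : ℕ} (h1 : ∀ i, i < N → val i ≤ 1) {p : ℕ}
    (hp : p < partialSum val N) : ∃ i, i < N ∧ 0 < val i ∧ partialSum val i = p := by
  induction N with
  | zero => simp [partialSum] at hp
  | succ N ih =>
    rw [partialSum_succ] at hp
    by_cases h : p < partialSum val N
    · obtain ⟨i, hi, h2⟩ := ih (fun i hi => h1 i (by omega)) h
      exact ⟨i, by omega, h2⟩
    · have := h1 N (by omega)
      exact ⟨N, by omega, by omega, by omega⟩

/-- The prefix sum before a flagged index is its rank among the flagged ones, so the output has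
neither gaps nor collisions. -/
theorem bijOn_packed {val vert out : ℕ → ℕ} {N o : ℕ} (h1 : ∀ i, i < N → val i ≤ 1)
    (hinj : ∀ i i', i < N → i' < N → 0 < val i → 0 < val i' → vert i = vert i' → i = i')
    (hout : ∀ i, i < N → 0 < val i → out (o + partialSum val i) = vert i) :
    Set.BijOn (fun p => out (o + p)) (Set.Iio (partialSum val N))
      {x | ∃ i, i < N ∧ 0 < val i ∧ vert i = x} := by
  refine ⟨fun p hp => ?_, fun p hp p' hp' h => ?_, ?_⟩
  · obtain ⟨i, hi, hv, rfl⟩ := exists_partialSum_eq h1 hp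
    exact ⟨i, hi, hv, (hout i hi hv).symm⟩
  · obtain ⟨i, hi, hv, rfl⟩ := exists_partialSum_eq h1 hp
    obtain ⟨i', hi', hv', rfl⟩ := exists_partialSum_eq h1 hp'
    have h : out (o + partialSum val i) = out (o + partialSum val i') := h
    rw [hout i hi hv, hout i' hi' hv'] at h
    rw [hinj i i' hi hi' hv hv' h]
  · rintro x ⟨i, hi, hv, rfl⟩
    refine ⟨partialSum val i, ?_, hout i hi hv⟩
    have := partialSum_mono val (Nat.succ_le_of_lt hi)
    rw [Nat.succ_eq_add_one, partialSum_succ] at this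
    simp
    omega

/-! ### The root thread and the composition of its phases -/

section Root

variable {n : ℕ} {σ : Type u} {M : Machine} {C : Fin n → σ → Bool}
  {F : Fin n → Fin n → σ → Bool × σ}

/-- A list without repetitions of the targets of the successful applications, read off from the
slots. -/
theorem ApplyInvariant.listedAt {k N : ℕ} {L ul deg slot : ℕ → ℕ} {s : Shared n σ}
    (hI : ApplyInvariant k L ul deg slot N s)
    (hslot : ∀ i j, i < k → j < deg i → slot (adjacent n L ul i j) < N)
    (hslot_inj : ∀ i j i' j', i < k → j < deg i → i' < k → j' < deg i' →
      slot (adjacent n L ul i j) = slot (adjacent n L ul i' j') →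
      adjacent n L ul i j = adjacent n L ul i' j')
    (hflag : ∀ u v : Fin n, .apply u v true ∈ s.calls → s.small (2 * (n + 1) + slot v) = 1)
    {out : ℕ → ℕ} {o : ℕ}
    (hout : ∀ i, i < N → 0 < s.small (2 * (n + 1) + i) →
      out (o + partialSum (fun i => s.small (2 * (n + 1) + i)) i) = s.small (4 * (n + 1) + i)) :
    ∃ U' : Finset (Fin n), (∀ v, v ∈ U' ↔ ∃ u, .apply u v true ∈ s.calls) ∧
      ListedAt out o (partialSum (fun i => s.small (2 * (n + 1) + i)) N) U' := by
  classical
  refine ⟨Finset.univ.filter fun v => ∃ u, .apply u v true ∈ s.calls, by simp, ?_⟩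
  have key : ∀ i, i < N → 0 < s.small (2 * (n + 1) + i) → ∃ u v : Fin n,
      .apply u v true ∈ s.calls ∧ slot v = i ∧ s.small (4 * (n + 1) + i) = v := by
    intro i hi hv
    rcases hI.slots i hi with h | ⟨-, h⟩
    · omega
    · exact h
  have hb := bijOn_packed (val := fun i => s.small (2 * (n + 1) + i))
    (vert := fun i => s.small (4 * (n + 1) + i)) (out := out) (N := N) (o := o)
    (fun i hi => by rcases hI.slots i hi with h | ⟨h, -⟩ <;> omega)
    (fun i i' hi hi' hv hv' h => by
      obtain ⟨u, v, -, h1, h2⟩ := key i hi hv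
      obtain ⟨u', v', -, h1', h2'⟩ := key i' hi' hv'
      rw [← h1, ← h1', ← h2, ← h2', h]) hout
  unfold ListedAt
  convert hb using 1
  ext x
  simp only [Finset.coe_filter, Finset.mem_univ, true_and, Set.mem_image, Set.mem_ofPred_eq]
  constructor
  · rintro ⟨v, ⟨u, hm⟩, rfl⟩
    obtain ⟨i, j, hi, hj, -, hv⟩ := hI.sound u v true hm
    have hlt : slot v < N := by
      rw [hv]
      exact hslot i j hi hj
    have hpos : 0 < s.small (2 * (n + 1) + slot v) := by
      rw [hflag u v hm]
      exact zero_lt_one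
    refine ⟨slot v, hlt, hpos, ?_⟩
    -- The slot of `v` may have been flagged on behalf of another application, but its target has
    -- the same slot and is therefore `v`.
    obtain ⟨u', v', hm', h1, h2⟩ := key _ hlt hpos
    obtain ⟨i', j', hi', hj', -, hv'⟩ := hI.sound u' v' true hm'
    rw [h2, hv, hv']
    exact hslot_inj i' j' i j hi' hj' hi hj (by rw [← hv, ← hv', h1])
  · rintro ⟨i, hi, hv, rfl⟩
    obtain ⟨u, v, hm, -, h2⟩ := key i hi hv
    exact ⟨v, ⟨u, hm⟩, h2.symm⟩

/-- The specification of the whole program. -/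
structure EdgeMapResult (k : ℕ) (L ul deg ρ : ℕ → ℕ) (s : Shared n σ) : Prop where
  sound : ∀ (u v : Fin n) b, .apply u v b ∈ s.calls →
    ∃ i j, i < k ∧ j < deg i ∧ (u : ℕ) = ul i ∧ (v : ℕ) = adjacent n L ul i j
  once : AppliedOnce s.calls
  guarded : Guarded s.calls
  complete : ∀ i j, i < k → j < deg i → ∃ u v : Fin n, (u : ℕ) = ul i ∧
    (v : ℕ) = adjacent n L ul i j ∧ ((∃ b, .apply u v b ∈ s.calls) ∨ .condition v false ∈ s.calls)
  bound : ρ 1 + ρ 2 ≤ 6 * (n + 1)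
  output : ∃ U' : Finset (Fin n), (∀ v, v ∈ U' ↔ ∃ u, .apply u v true ∈ s.calls) ∧
    ListedAt s.small (ρ 1) (ρ 2) U'

/-- No environment. -/
theorem protocol_eq :
    Protocol (fun a b : Shared n σ => a = b) (fun _ _ : Shared n σ => True) :=
  ⟨fun _ => rfl, fun _ _ _ => Eq.trans, fun _ => trivial⟩

/-- The root runs the divide-and-conquer procedure on a range from `0` to `K`. -/
theorem Run.call {ι : Type*} {A : Set ι → Shared n σ → Shared n σ → Prop} (hA : IsAction A)
    {Z : Set ι} {Post : Shared n σ → Prop} {Q : (ℕ → ℕ) → Shared n σ → Prop}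
    {m₁ e₁ m₃ e₃ pc K : ℕ} {ρ : ℕ → ℕ} {s : Shared n σ}
    (hi : edgeMapProgram[pc]? = some .fork)
    (hi' : edgeMapProgram[pc + 1]? = some (.jumpIfLt 11 0 46))
    (h11 : ρ 11 = 0) (h12 : ρ 12 = 1) (h3 : ρ 3 = 0) (h4 : ρ 4 = K)
    (hpos : 0 < K → Run M C F edgeMapProgram (A ∅) (A Z) (fun _ => Post) m₁ e₁ 47
      (Function.update ρ 0 1) s)
    (hzero : K = 0 → ∀ s', A ∅ s s' → Post s')
    (cont : ∀ s', Post s' → A Z s s' → Run M C F edgeMapProgram (· = ·) (fun _ _ => True) Q m₃ e₃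
      (pc + 2) (Function.update ρ 0 0) s') :
    Run M C F edgeMapProgram (· = ·) (fun _ _ => True) Q (m₃ + (m₁ + 12)) (e₃ + (e₁ + 6)) pc ρ s := by
  have hE₁ := hA.protocol ∅ Z
  -- A procedure call is a fork whose second child ends at once: it tolerates every change and makes
  -- none.
  have hE₂ : Protocol (fun _ _ : Shared n σ => True) (fun a b : Shared n σ => a = b) :=
    ⟨fun _ => trivial, fun _ _ _ _ _ => trivial, fun _ => rfl⟩
  refine Run.weaken (m := (m₁ + 2 + 2) + 3 + (m₃ + 1) + 2) (e := (e₁ + 2 + 2) + (e₃ + 1) + 1) ?_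
    (by omega) (by omega)
  refine Run.fork (Q₁ := fun s' => Post s' ∧ A Z s s') (Q₂ := fun _ => True) hi protocol_eq hE₁ hE₂
    (by rintro a b rfl; exact hA.refl _ _) (fun _ _ _ => trivial) (fun _ _ _ => trivial)
    (by rintro a b rfl; exact hA.refl _ _) (fun _ _ _ => trivial) (fun _ _ _ => trivial) ?_ ?_ ?_
  -- The history tells the root what the call left unchanged, which the postcondition alone does
  -- not.
  · refine Run.history (Q := fun _ => Post) (hA.trans Z) (hA.refl Z)
      (fun a b => hA.mono _ _ _ _ (Set.empty_subset _)) (fun _ _ h => h) ?_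
    refine Run.jumpIfLt_true hi' hE₁ (by simp [h11]) ?_
    refine Run.jumpIfLt_false rfl hE₁ (by simp [h12]) ?_
    rcases Nat.eq_zero_or_pos K with h0 | h0
    · refine Run.weaken (m := 2) (e := 2) ?_ (by omega) (by omega)
      refine Run.jumpIfLt_false rfl hE₁ (by simp [h3, h4, h0]) ?_
      exact Run.halt rfl hE₁ fun s' hs' => hzero h0 s' hs'
    · exact (hpos h0).weaken (by omega) (by omega)
  · refine Run.weaken (m := 3) (e := 3) ?_ le_rfl (by omega)
    refine Run.jumpIfLt_true hi' hE₂ (by simp [h11]) ?_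
    refine Run.jumpIfLt_true rfl hE₂ (by simp [h12]) ?_
    exact Run.halt rfl hE₂ fun _ _ => trivial
  · rintro s' ⟨hp, hs'⟩ -
    exact Run.jumpIfLt_false hi' protocol_eq (by simp [h11]) (cont s' hp hs')

/-- The registers of the root. -/
structure RootRegisters (n k : ℕ) (ρ : ℕ → ℕ) : Prop where
  r3 : ρ 3 = 0
  r10 : ρ 10 = n
  r11 : ρ 11 = 0
  r12 : ρ 12 = 1
  r13 : ρ 13 = 2
  r16 : ρ 16 = n + 1
  r17 : ρ 17 = 2 * (n + 1)
  r18 : ρ 18 = 3 * (n + 1)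
  r19 : ρ 19 = 4 * (n + 1)
  r20 : ρ 20 = 5 * (n + 1)
  r22 : ρ 22 = k

theorem RootRegisters.ctx {k : ℕ} {ρ : ℕ → ℕ} (h : RootRegisters n k ρ) : Ctx ρ ρ :=
  ⟨fun _ _ => rfl, h.r11, h.r12, h.r13⟩

theorem RootRegisters.update {k : ℕ} {ρ : ℕ → ℕ} (h : RootRegisters n k ρ) {r : ℕ} (x : ℕ)
    (hr : r ≠ 3 ∧ (r < 10 ∨ 14 ≤ r) ∧ (r < 16 ∨ r = 21 ∨ 23 ≤ r)) :
    RootRegisters n k (Function.update ρ r x) := by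
  obtain ⟨h1, h2, h3⟩ := hr
  constructor <;> rw [Function.update_of_ne (by omega)]
  exacts [h.r3, h.r10, h.r11, h.r12, h.r13, h.r16, h.r17, h.r18, h.r19, h.r20, h.r22]

/-- From the application of the user functions to the end. -/
theorem Run.applyAndPack {k : ℕ} {L ul deg : ℕ → ℕ} (hin : IsVertexList n k L ul deg)
    (hw : 2 * (n * n) + 8 * (n + 1) < 2 ^ M.wordBits) (hs : 6 * (n + 1) ≤ M.smallWords)
    {h : ℕ} (hh : n + 1 ≤ 2 ^ h) {ρ : ℕ → ℕ} {s : Shared n σ} (hreg : RootRegisters n k ρ)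
    (h4 : ρ 4 = k) (h5 : ρ 5 = 0) (h6 : ρ 6 = partialSum deg k) (h15 : ρ 15 = n + 1)
    (h23 : ρ 23 = min (partialSum deg k) n)
    (hL : s.large = L) (hlist : ∀ i, i < k → s.small i = ul i)
    (hS : Sums (fun i => s.small (n + 1 + i)) (partialSum deg) 0 k) (hcalls : s.calls = [])
    (hzero : ∀ i, i < min (partialSum deg k) n + 1 → s.small (2 * (n + 1) + i) = 0)
    (hslots : ∀ i j, i < k → j < deg i → IsSlot n k L ul deg (adjacent n L ul i j)
        (s.small (3 * (n + 1) + adjacent n L ul i j))) :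
    Run M C F edgeMapProgram (· = ·) (fun _ _ => True) (EdgeMapResult k L ul deg)
      (∑ i ∈ Finset.range k, (deg i * (23 + 60) + 80) + 135 * min (partialSum deg k) n + 100)
      (200 + 96 * h) 31 ρ s := by
  have hE := protocol_eq (n := n) (σ := σ)
  have hcard := hin.card_le
  have hsum := hin.partialSum_le
  obtain ⟨N, hN⟩ : ∃ N, N = min (partialSum deg k) n := ⟨_, rfl⟩
  rw [← hN] at h23 hzero ⊢
  have hNn : N ≤ n := by omega
  -- The slots are fixed from here on. For vertices that are not targets, `slot` is whatever the
  -- memory contains, and is never used.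
  obtain ⟨slot, hslot⟩ : ∃ slot : ℕ → ℕ, ∀ v, s.small (3 * (n + 1) + v) = slot v :=
    ⟨_, fun _ => rfl⟩
  simp only [hslot] at hslots
  have hslot_lt : ∀ i j, i < k → j < deg i → slot (adjacent n L ul i j) < N := by
    intro i j hi hj
    rw [hN]
    exact (hslots i j hi hj).lt (hin.adjacent_lt i j hi hj)
  have hslot_inj : ∀ i j i' j', i < k → j < deg i → i' < k → j' < deg i' →
      slot (adjacent n L ul i j) = slot (adjacent n L ul i' j') →
      adjacent n L ul i j = adjacent n L ul i' j' := by
    intro i j i' j' hi hj hi' hj' he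
    have := hslots i j hi hj
    rw [he] at this
    exact this.injective (hslots i' j' hi' hj')
  have hinv : ApplyInvariant k L ul deg slot N s :=
    ⟨by simp [hcalls], by simp [AppliedOnce, hcalls],
      by simp [Guarded, hcalls], fun i hi => .inl (hzero i (by omega))⟩
  refine Run.weaken
    (m := ((((2 + (N * (12 + 60) + 12)) + 3) + (N * (3 + 60) + 12)) + 3 +
      (∑ i ∈ Finset.range k, (deg i * (23 + 60) + 80) + 12)) + 1)
    (e := ((((2 + (12 + 4 + 24 * h + 6)) + 3) + (3 + 4 + 24 * h + 6)) + 3 +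
      (23 + 26 + 48 * h + 6)) + 1) ?_ (by omega) (by omega)
  refine Run.const rfl hE (by omega) ?_
  have hreg1 := hreg.update (r := 14) 7 (by norm_num)
  refine Run.call (isAction_applyAction k L ul deg slot N) rfl rfl hreg1.r11 hreg1.r12 hreg1.r3
    (by simpa using h4) (fun hk => Run.applications hin hw hs hNn hslot_lt hslot_inj (by simp)
      (by simpa using h15) hreg1.r16 hreg1.r17 hreg1.r18 hreg1.r19 hk (by omega)
      (hreg1.ctx.update (by norm_num) _) (by simpa using hreg.r3) (by simpa using h4)
      (by simpa using h5) (by simpa using h6) hL hlist hS hcalls fun v _ => hslot v)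
    (fun hk s' _ i j hi => by omega) fun s1 hp1 hs1 => ?_
  replace hinv := hs1.invariant hinv
  have hflag : ∀ u v : Fin n, .apply u v true ∈ s1.calls → s1.small (2 * (n + 1) + slot v) = 1 := by
    intro u v hm
    obtain ⟨i, j, hi, hj, hu, hv⟩ := hinv.sound u v true hm
    obtain ⟨u', v', hu', hv', -, h⟩ := hp1 i j hi hj
    obtain rfl : u' = u := Fin.ext (hu'.trans hu.symm)
    obtain rfl : v' = v := Fin.ext (hv'.trans hv.symm)
    exact h hm
  -- Without slots the calls for summation and packing do nothing, and the length of the output is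
  -- then read from this word.
  have hzero1 : N = 0 → s1.small (2 * (n + 1)) = 0 := fun h0 => by
    rw [hs1.small _ (by omega)]
    exact hzero 0 (by omega)
  clear hs1 hzero hS hlist hL hcalls hslot
  obtain ⟨val, hval⟩ : ∃ val : ℕ → ℕ, ∀ i, s1.small (2 * (n + 1) + i) = val i := ⟨_, fun _ => rfl⟩
  have hps : partialSum val N ≤ N := by
    calc partialSum val N ≤ ∑ _i ∈ Finset.range N, 1 := by
          refine Finset.sum_le_sum fun i hi => ?_
          have := hinv.slots i (Finset.mem_range.1 hi)
          rw [hval] at this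
          rcases this with h | ⟨h, -⟩ <;> omega
      _ = N := by simp
  refine Run.const rfl hE (by omega) ?_
  refine Run.move (2 * (n + 1)) rfl hE (by simp [hreg.r17]) (by simp [hreg.r11]) (by omega) ?_
  refine Run.move N rfl hE (by simp [h23]) (by simp [hreg.r11]) (by omega) ?_
  have hreg2 := (((hreg1.update (r := 0) 0 (by norm_num)).update (r := 14) 1
    (by norm_num)).update (r := 15) (2 * (n + 1)) (by norm_num)).update (r := 4) N (by norm_num)
  refine Run.call isAction_arrayAction rfl rfl hreg2.r11 hreg2.r12 hreg2.r3 (K := N) (by simp)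
    (fun hk => Run.arraySums (a := 2 * (n + 1)) (val := val) (by simp) (by simp) (by omega)
      (by omega) (by omega) (by omega) hk (by omega) (hreg2.ctx.update (by norm_num) _)
      (by simpa using hreg.r3) (by simp) fun i _ => hval i)
    ?_ fun s2 hp2 hs2 => ?_
  · rintro rfl s' hs'
    refine ⟨?_, .short (by norm_num)⟩
    rw [hs'.small _ (by simp), hzero1 rfl]
    simp [partialSum]
  refine Run.loadSmall rfl hE (by simp [hreg.r17]; omega) ?_
  rintro s2' rfl
  have e1 : ∀ ρ : ℕ → ℕ, ρ 17 = 2 * (n + 1) → s2.small (ρ 17) = partialSum val N := fun ρ h => by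
    rw [h, hp2.1]
  rw [e1 _ (by simp [hreg.r17])]
  refine Run.move (partialSum val N) rfl hE (by simp) (by simp [hreg.r11]) (by omega) ?_
  refine Run.const rfl hE (by omega) ?_
  have hreg3 := (((hreg2.update (r := 0) 0 (by norm_num)).update (r := 2) (partialSum val N)
    (by norm_num)).update (r := 6) (partialSum val N) (by norm_num)).update (r := 14) 3
    (by norm_num)
  refine Run.call isAction_arrayAction rfl rfl hreg3.r11 hreg3.r12 hreg3.r3 (K := N) (by simp)
    (fun hk => Run.pack (a := 2 * (n + 1)) (v := 4 * (n + 1)) (o := 5 * (n + 1)) (val := val)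
      (vert := fun i => s1.small (4 * (n + 1) + i))
      (by simp) (by simp) hreg3.r19 hreg3.r20 (by omega) (by omega) (by omega) (by omega)
      (by omega) (by omega) hps hk (by omega) (hreg3.ctx.update (by norm_num) _)
      (by simpa using hreg.r3) (by simp) (by simpa using h5) (by simp) hp2.2
      fun i hi => hs2.small _ (by simp; omega))
    (fun hk s' _ i hi => by omega) fun s3 hp3 hs3 => ?_
  refine Run.move (5 * (n + 1)) rfl hE (by simp [hreg.r20]) (by simp [hreg.r11]) (by omega) ?_
  refine Run.halt rfl hE ?_
  rintro s3' rfl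
  have hc : s3.calls = s1.calls := hs3.calls.trans hs2.calls
  have hout := hinv.listedAt hslot_lt hslot_inj hflag (out := s3.small) (o := 5 * (n + 1))
    (by simpa only [hval] using hp3)
  simp only [hval] at hout
  refine ⟨?_, ?_, ?_, ?_, ?_, ?_⟩
  · simpa only [hc] using hinv.sound
  · simpa only [hc] using hinv.once
  · simpa only [hc] using hinv.guarded
  · intro i j hi hj
    obtain ⟨u, v, hu, hv, h, -⟩ := hp1 i j hi hj
    exact ⟨u, v, hu, hv, by simpa only [hc] using h⟩
  · simp
    omega
  · simpa [hc] using hout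

/-- From the computation of the slots to the end. -/
theorem Run.slotsAndApply {k : ℕ} {L ul deg : ℕ → ℕ} (hin : IsVertexList n k L ul deg)
    (hw : 2 * (n * n) + 8 * (n + 1) < 2 ^ M.wordBits) (hs : 6 * (n + 1) ≤ M.smallWords)
    {h : ℕ} (hh : n + 1 ≤ 2 ^ h) {ρ : ℕ → ℕ} {s : Shared n σ} (hreg : RootRegisters n k ρ)
    (h15 : ρ 15 = n + 1) (h21 : ρ 21 = partialSum deg k)
    (h23 : ρ 23 = min (partialSum deg k) n)
    (hL : s.large = L) (hlist : ∀ i, i < k → s.small i = ul i)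
    (hS : Sums (fun i => s.small (n + 1 + i)) (partialSum deg) 0 k) (hcalls : s.calls = []) :
    Run M C F edgeMapProgram (· = ·) (fun _ _ => True) (EdgeMapResult k L ul deg)
      (∑ i ∈ Finset.range k, (deg i * (23 + 60) + 80) +
        ∑ i ∈ Finset.range k, (deg i * (15 + 60) + 80) + 202 * min (partialSum deg k) n + 300)
      (300 + 168 * h) 21 ρ s := by
  have hE := protocol_eq (n := n) (σ := σ)
  have hcard := hin.card_le
  have hsum := hin.partialSum_le
  obtain ⟨N, hN⟩ : ∃ N, N = min (partialSum deg k) n := ⟨_, rfl⟩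
  rw [← hN] at h23
  have hNn : N ≤ n := by omega
  refine Run.weaken
    (m := ((∑ i ∈ Finset.range k, (deg i * (23 + 60) + 80) + 135 * min (partialSum deg k) n + 100 +
      (∑ i ∈ Finset.range k, (deg i * (15 + 60) + 80) + 12)) + 4 + ((N + 1) * (7 + 60) + 12)) + 2)
    (e := ((200 + 96 * h + (15 + 26 + 48 * h + 6)) + 4 + (7 + 4 + 24 * h + 6)) + 2) ?_
    (by omega) (by omega)
  refine Run.const rfl hE (by omega) ?_
  -- One word more than the number of slots is cleared, so that the word holding the total is `0`
  -- even if there are no slots.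
  refine Run.add N 1 rfl hE (by simpa using h23) (by simp [hreg.r12]) (by omega) ?_
  have hreg1 := (hreg.update (r := 14) 2 (by norm_num)).update (r := 4) (N + 1) (by norm_num)
  refine Run.call isAction_arrayAction rfl rfl hreg1.r11 hreg1.r12 hreg1.r3 (K := N + 1) (by simp)
    (fun hk => Run.zeros (a := 2 * (n + 1)) (by simp) hreg1.r17 (by omega) (by omega)
      (by simp [h15]; omega) (by simp [h15]; omega) (by omega) (by omega) hk (by omega)
      (hreg1.ctx.update (by norm_num) _) (by simpa using hreg.r3) (by simp))
    (fun hk => by omega) fun s1 hp1 hs1 => ?_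
  refine Run.const rfl hE (by omega) ?_
  refine Run.move k rfl hE (by simp [hreg.r22]) (by simp [hreg.r11]) (by omega) ?_
  refine Run.const rfl hE (by omega) ?_
  refine Run.move (partialSum deg k) rfl hE (by simp [h21]) (by simp [hreg.r11]) (by omega) ?_
  have hreg2 := ((((hreg1.update (r := 0) 0 (by norm_num)).update (r := 14) 6
    (by norm_num)).update (r := 4) k (by norm_num)).update (r := 5) 0 (by norm_num)).update (r := 6)
    (partialSum deg k) (by norm_num)
  refine Run.call (isAction_slotAction _) rfl rfl hreg2.r11 hreg2.r12 hreg2.r3 (K := k) (by simp)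
    (fun hk => Run.slots hin hw hs (by simp) hreg2.r10 (by simpa using h15) hreg2.r16 hreg2.r18
      (by simpa using h21) hk (by omega) (hreg2.ctx.update (by norm_num) _)
      (by simpa using hreg.r3) (by simp) (by simp) (by simp) (hs1.large.trans hL)
      (fun i hi => (hs1.small _ (by simp; omega)).trans (hlist i hi))
      (hS.congr fun i _ hi => hs1.small _ (by simp; omega)))
    (fun hk s' _ i j hi => by omega) fun s2 hp2 hs2 => ?_
  refine Run.applyAndPack hin hw hs hh (hreg2.update (r := 0) 0 (by norm_num)) (by simp) (by simp)
    (by simp) (by simpa using h15) (by simpa [hN] using h23) (hs2.large.trans (hs1.large.trans hL))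
    (fun i hi => ?_) (hS.congr fun i _ hi => ?_) (hs2.calls.trans (hs1.calls.trans hcalls))
    (fun i hi => ?_) hp2
  · rw [hs2.small _ (by omega), hs1.small _ (by simp; omega), hlist i hi]
  · rw [hs2.small _ (by omega), hs1.small _ (by simp; omega)]
  · rw [hs2.small _ (by omega), hp1 i (by omega)]

theorem Run.edgeMap {k : ℕ} {L ul deg : ℕ → ℕ} (hin : IsVertexList n k L ul deg)
    (hw : 2 * (n * n) + 8 * (n + 1) < 2 ^ M.wordBits) (hs : 6 * (n + 1) ≤ M.smallWords)
    {h : ℕ} (hh : n + 1 ≤ 2 ^ h) {ρ : ℕ → ℕ} {s : Shared n σ} (h1 : ρ 1 = n) (h2 : ρ 2 = k)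
    (hL : s.large = L) (hlist : ∀ i, i < k → s.small i = ul i) (hcalls : s.calls = []) :
    Run M C F edgeMapProgram (· = ·) (fun _ _ => True) (EdgeMapResult k L ul deg)
      (360 * partialSum deg k + 229 * k + 400) (400 + 192 * h) 0 ρ s := by
  have hE := protocol_eq (n := n) (σ := σ)
  have hcard := hin.card_le
  have hsum := hin.partialSum_le
  have hm : ∀ c, ∑ i ∈ Finset.range k, (deg i * c + 80) = partialSum deg k * c + k * 80 := fun c => by
    rw [Finset.sum_add_distrib, partialSum, Finset.sum_mul]
    simp
  -- The coefficient of the sum of the degrees is `83 + 75` for the two passes over the edges and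
  -- `202` for clearing, summing and packing the slots; that of `k` is `80 + 80 + 69`. The depth
  -- `192 * h` comes from four single recursions and two nested ones, at `24 * h` per level of
  -- nesting.
  refine Run.weaken
    (m := ((∑ i ∈ Finset.range k, (deg i * (23 + 60) + 80) +
        ∑ i ∈ Finset.range k, (deg i * (15 + 60) + 80) + 202 * min (partialSum deg k) n + 300) + 4 +
        (k * (9 + 60) + 12)) + 15)
    (e := ((300 + 168 * h) + 4 + (9 + 4 + 24 * h + 6)) + 15) ?_ (by rw [hm, hm]; omega) (by omega)
  refine Run.const rfl hE (by omega) ?_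
  refine Run.const rfl hE (by omega) ?_
  refine Run.const rfl hE (by omega) ?_
  refine Run.move n rfl hE (by simp [h1]) (by simp) (by omega) ?_
  refine Run.move k rfl hE (by simp [h2]) (by simp) (by omega) ?_
  refine Run.add n 1 rfl hE (by simp) (by simp) (by omega) ?_
  refine Run.add (n + 1) (n + 1) rfl hE (by simp) (by simp) (by omega) ?_
  refine Run.add (n + 1 + (n + 1)) (n + 1) rfl hE (by simp) (by simp) (by omega) ?_
  refine Run.add (n + 1 + (n + 1) + (n + 1)) (n + 1) rfl hE (by simp) (by simp) (by omega) ?_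
  refine Run.add (n + 1 + (n + 1) + (n + 1) + (n + 1)) (n + 1) rfl hE (by simp) (by simp)
    (by omega) ?_
  -- For empty `U` the summation does nothing, and this `0` is then read as the sum of the degrees.
  refine Run.storeSmall rfl (by simp; omega) ?_
  rintro s0 rfl
  refine ⟨trivial, ?_⟩
  simp only [Function.update_self, ne_eq, Nat.reduceEqDiff,
    not_false_eq_true, Function.update_of_ne]
  refine Run.const rfl hE (by omega) ?_
  refine Run.move (n + 1) rfl hE (by simp) (by simp) (by omega) ?_
  refine Run.const rfl hE (by omega) ?_
  refine Run.move k rfl hE (by simp) (by simp) (by omega) ?_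
  generalize hρ₁ : Function.update (β := fun _ => ℕ) (Function.update (Function.update
    (Function.update _ 14 0) 15 (n + 1)) 3 0) 4 k = ρ₁
  have hreg : RootRegisters n k ρ₁ := by
    rw [← hρ₁]
    constructor <;> simp <;> omega
  have r4 : ρ₁ 4 = k := by simp [← hρ₁]
  have r14 : ρ₁ 14 = 0 := by simp [← hρ₁]
  have r15 : ρ₁ 15 = n + 1 := by simp [← hρ₁]
  clear hρ₁
  refine Run.call isAction_arrayAction rfl rfl hreg.r11 hreg.r12 hreg.r3 r4
    (fun hk => Run.degreeSums (a := n + 1) (L := L) (ul := ul) (deg := deg) r14 r15 hreg.r16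
      (by omega) (by omega) (by omega) (by omega) (by omega) hin.offset_succ
      (fun i hi => lt_of_le_of_lt (hin.offset_le i hi) (by omega))
      (fun i hi => lt_of_le_of_lt (hin.lt i hi) (by omega)) hk (by omega)
      (hreg.ctx.update (by norm_num) _) (by simpa using hreg.r3) (by simpa using r4) hL
      fun i hi => (Function.update_of_ne (by omega) _ _).trans (hlist i hi))
    ?_ fun s1 hp1 hs1 => ?_
  · rintro rfl s' hs'
    refine ⟨?_, .short (by norm_num)⟩
    rw [hs'.small _ (by simp)]
    simp [partialSum]
  have hreg1 := hreg.update (r := 0) 0 (by norm_num)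
  refine Run.loadSmall rfl hE (by simp [hreg.r16]; omega) ?_
  rintro s1' rfl
  rw [hreg1.r16, hp1.1]
  have key := Run.slotsAndApply (M := M) (C := C) (F := F) hin hw hs hh (s := s1)
    ((hreg1.update (r := 21) (partialSum deg k) (by norm_num)).update (r := 23)
      (min (partialSum deg k) n) (by norm_num)) (by simpa using r15) (by simp) (by simp)
    (hs1.large.trans hL) (fun i hi => ?_) hp1.2 (hs1.calls.trans hcalls)
  · refine Run.move (partialSum deg k) rfl hE (by simp) (by simp [hreg.r11]) (by omega) ?_
    rcases lt_or_ge (partialSum deg k) n with hD | hD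
    · refine Run.jumpIfLt_true rfl hE (by simpa [hreg.r10] using hD) ?_
      rw [min_eq_left hD.le] at key ⊢
      exact key.weaken (by omega) (by omega)
    · refine Run.jumpIfLt_false rfl hE (by simpa [hreg.r10] using hD) ?_
      refine Run.move n rfl hE (by simp [hreg.r10]) (by simp [hreg.r11]) (by omega) ?_
      rw [min_eq_right hD] at key ⊢
      simpa only [Function.update_idem] using key
  · rw [hs1.small _ (by simp; omega)]
    exact (Function.update_of_ne (by omega) _ _).trans (hlist i hi)

end Root

/-! ### The input -/

section Input

variable {n : ℕ} {σ : Type u}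

/-- An offset is a sum of `v` degrees, each one less than `n`; so addresses in the adjacency lists
fit into words. -/
theorem IsCSR.offset_le {G : SimpleGraph (Fin n)} [DecidableRel G.Adj] {mem : ℕ → ℕ}
    (h : IsCSR G mem) : ∀ v, v ≤ n → mem v ≤ v * n := by
  intro v
  induction v with
  | zero => simp [h.offset_zero]
  | succ v ih =>
    intro hv
    have h1 := h.offset_succ ⟨v, hv⟩
    have h2 := G.degree_lt_card_verts ⟨v, hv⟩
    rw [Fintype.card_fin] at h2
    have h3 := ih (by omega)
    simp only at h1
    rw [add_one_mul]
    omega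

/-- The degrees of the vertices in a list. -/
def degreeAt (G : SimpleGraph (Fin n)) [DecidableRel G.Adj] (ul : ℕ → ℕ) (i : ℕ) : ℕ :=
  if h : ul i < n then G.degree ⟨ul i, h⟩ else 0

theorem degreeAt_eq {G : SimpleGraph (Fin n)} [DecidableRel G.Adj] {ul : ℕ → ℕ} {i : ℕ}
    {u : Fin n} (h : ul i = u) : degreeAt G ul i = G.degree u := by
  have hlt : ul i < n := h ▸ u.isLt
  rw [degreeAt, dif_pos hlt, show (⟨ul i, hlt⟩ : Fin n) = u from Fin.ext h]

variable {M : Machine} {G : SimpleGraph (Fin n)} [DecidableRel G.Adj] {U : Finset (Fin n)}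
  {x : Config n σ}

theorem IsInitial.exists_mem (h : IsInitial M G U x) {i : ℕ} (hi : i < U.card) :
    ∃ u ∈ U, x.shared.small i = u := by
  obtain ⟨u, hu, e⟩ := h.subset.mapsTo (show i ∈ Set.Iio U.card from hi)
  exact ⟨u, hu, by simpa using e.symm⟩

/-- From here on the graph enters only through positions in lists; injectivity comes from the
bijections in the input format. -/
theorem IsInitial.isVertexList (h : IsInitial M G U x) :
    IsVertexList n U.card x.shared.large x.shared.small (degreeAt G x.shared.small) where
  card_le := by simpa using Finset.card_le_univ U
  lt i hi := by
    obtain ⟨u, -, e⟩ := h.exists_mem hi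
    rw [e]
    exact u.isLt
  injective i i' hi hi' he := h.subset.injOn (show i ∈ Set.Iio U.card from hi)
    (show i' ∈ Set.Iio U.card from hi') (by simpa using he)
  offset_succ i hi := by
    obtain ⟨u, -, e⟩ := h.exists_mem hi
    rw [degreeAt_eq e, e, h.graph.offset_succ u]
  offset_le i hi := by
    obtain ⟨u, -, e⟩ := h.exists_mem hi
    have hu := u.isLt
    rw [e]
    exact (h.graph.offset_le _ (by omega)).trans (Nat.mul_le_mul_right n (by omega))
  deg_le i hi := by
    obtain ⟨u, -, e⟩ := h.exists_mem hi
    rw [degreeAt_eq e]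
    have := G.degree_lt_card_verts u
    rw [Fintype.card_fin] at this
    exact this.le
  adjacent_lt i j hi hj := by
    obtain ⟨u, -, e⟩ := h.exists_mem hi
    rw [degreeAt_eq e] at hj
    obtain ⟨v, -, hv⟩ := (h.graph.neighbors u).mapsTo (show j ∈ Set.Iio _ from hj)
    simp only at hv
    rw [adjacent, e, ← hv]
    exact v.isLt
  adjacent_injective i j j' hi hj hj' he := by
    obtain ⟨u, -, e⟩ := h.exists_mem hi
    rw [degreeAt_eq e] at hj hj'
    rw [adjacent, adjacent, e] at he
    exact (h.graph.neighbors u).injOn (show j ∈ Set.Iio _ from hj) (show j' ∈ Set.Iio _ from hj') he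

theorem IsInitial.adj (h : IsInitial M G U x) {i j : ℕ} (hi : i < U.card)
    (hj : j < degreeAt G x.shared.small i) {u v : Fin n} (hu : (u : ℕ) = x.shared.small i)
    (hv : (v : ℕ) = adjacent n x.shared.large x.shared.small i j) : u ∈ U ∧ G.Adj u v := by
  obtain ⟨u', hu', e⟩ := h.exists_mem hi
  obtain rfl : u = u' := Fin.ext (hu.trans e)
  rw [degreeAt_eq e] at hj
  obtain ⟨v', hv', e'⟩ := (h.graph.neighbors u).mapsTo (show j ∈ Set.Iio _ from hj)
  rw [adjacent, e] at hv
  obtain rfl : v = v' := Fin.ext (hv.trans e'.symm)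
  exact ⟨hu', by simpa using hv'⟩

/-- Together with `IsInitial.adj` this identifies the index pairs with the edges leaving `U`. -/
theorem IsInitial.exists_position (h : IsInitial M G U x) {u v : Fin n} (hu : u ∈ U)
    (hv : G.Adj u v) : ∃ i j, i < U.card ∧ j < degreeAt G x.shared.small i ∧
      (u : ℕ) = x.shared.small i ∧ (v : ℕ) = adjacent n x.shared.large x.shared.small i j := by
  obtain ⟨i, hi, e⟩ := h.subset.surjOn (show (u : ℕ) ∈ Fin.val '' (U : Set (Fin n)) from ⟨u, hu, rfl⟩)
  have e : x.shared.small i = u := by simpa using e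
  obtain ⟨j, hj, e'⟩ := (h.graph.neighbors u).surjOn
    (show (v : ℕ) ∈ Fin.val '' (G.neighborFinset u : Set (Fin n)) from ⟨v, by simpa using hv, rfl⟩)
  refine ⟨i, j, hi, ?_, e.symm, ?_⟩
  · rw [degreeAt_eq e]
    exact hj
  · rw [adjacent, e]
    exact e'.symm

theorem IsInitial.partialSum_degreeAt (h : IsInitial M G U x) :
    partialSum (degreeAt G x.shared.small) U.card = ∑ u ∈ U, G.degree u := by
  have key : ∀ i, i < U.card → ∃ u ∈ U, x.shared.small i = u := fun i hi => h.exists_mem hi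
  choose f hf hf' using key
  refine Finset.sum_bij (fun i hi => f i (Finset.mem_range.1 hi)) (fun i hi => hf _ _)
    (fun i hi i' hi' he => ?_) (fun u hu => ?_) (fun i hi => degreeAt_eq (hf' _ _))
  · refine h.isVertexList.injective i i' (Finset.mem_range.1 hi) (Finset.mem_range.1 hi') ?_
    rw [hf' _ (Finset.mem_range.1 hi), hf' _ (Finset.mem_range.1 hi'), he]
  · obtain ⟨i, hi, e⟩ := h.subset.surjOn
      (show (u : ℕ) ∈ Fin.val '' (U : Set (Fin n)) from ⟨u, hu, rfl⟩)
    have e : x.shared.small i = u := by simpa using e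
    exact ⟨i, Finset.mem_range.2 hi, Fin.ext ((hf' i hi).symm.trans e)⟩

theorem EdgeMapResult.isEdgeMapOutput {M' : Machine} {y : Config n σ} {t : Thread}
    (h : IsInitial M G U x) (hs : 6 * (n + 1) ≤ M'.smallWords) (ht : y.tree = .ended t)
    (hres : EdgeMapResult U.card x.shared.large x.shared.small (degreeAt G x.shared.small) t.reg
      y.shared) : IsEdgeMapOutput M' G U y := by
  refine ⟨⟨fun u v b hm => ?_, hres.once, hres.guarded, fun u v hu hv => ?_⟩, ?_⟩
  · obtain ⟨i, j, hi, hj, hu, hv⟩ := hres.sound u v b hm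
    exact h.adj hi hj hu hv
  · obtain ⟨i, j, hi, hj, eu, ev⟩ := h.exists_position hu hv
    obtain ⟨u', v', hu', hv', hc⟩ := hres.complete i j hi hj
    obtain rfl : u' = u := Fin.ext (hu'.trans eu.symm)
    obtain rfl : v' = v := Fin.ext (hv'.trans ev.symm)
    exact hc
  · obtain ⟨U', h1, h2⟩ := hres.output
    exact ⟨t, U', ht, h1, hres.bound.trans hs, h2⟩

end Input

/-- All addresses and sums are at most quadratic in `n`, so about `2 * log n` bits with a constant
margin suffice. -/
theorem two_mul_sq_add_lt_two_pow {n w : ℕ} (hw : 1000 * (Nat.log 2 n + 1) ≤ w) :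
    2 * (n * n) + 8 * (n + 1) < 2 ^ w := by
  have h1 : n < 2 ^ (Nat.log 2 n + 1) := Nat.lt_pow_succ_log_self (by norm_num) n
  obtain ⟨a, ha⟩ : ∃ a, a = 2 ^ (Nat.log 2 n + 1) := ⟨_, rfl⟩
  rw [← ha] at h1
  calc 2 * (n * n) + 8 * (n + 1) < 16 * (a * a) := by nlinarith
    _ = 2 ^ (2 * (Nat.log 2 n + 1) + 4) := by rw [ha]; ring
    _ ≤ 2 ^ w := Nat.pow_le_pow_right (by norm_num) (by omega)

end PSAM

theorem mainTheorem1 :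
    ∃ (P : PSAM.Program) (c : ℕ),
      ∀ (n : ℕ) (G : SimpleGraph (Fin n)) [DecidableRel G.Adj] (U : Finset (Fin n))
        (σ : Type u) (C : Fin n → σ → Bool) (F : Fin n → Fin n → σ → Bool × σ)
        (M : PSAM.Machine) (x : PSAM.Config n σ),
        c * (Nat.log 2 n + 1) ≤ M.wordBits →
        M.smallWords = c * (n + 1) →
        1 < M.writeCost →
        PSAM.IsInitial M G U x →
        PSAM.Terminates M C F P x ∧
        ∀ y : PSAM.Config n σ, PSAM.Reachable M C F P x y →
          y.work ≤ c * (1 + ∑ u ∈ U, max 1 (G.degree u) : ℕ) ∧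
          y.tree.depth ≤ c * (Nat.log 2 n + 1 : ℕ) ∧
          (y.Finished → PSAM.IsEdgeMapOutput M G U y) := by
  refine ⟨PSAM.edgeMapProgram, 1000, ?_⟩
  intro n G _ U σ C F M x hw hs _ hx
  have hcap : 6 * (n + 1) ≤ M.smallWords := by omega
  have hrun := PSAM.Run.edgeMap (C := C) (F := F) hx.isVertexList
    (PSAM.two_mul_sq_add_lt_two_pow hw) hcap (h := Nat.log 2 n + 1)
    (Nat.lt_pow_succ_log_self (by norm_num) n)
    (ρ := fun r => if r = 1 then n else if r = 2 then U.card else 0) (s := x.shared)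
    (by simp) (by simp) rfl (fun _ _ => rfl) hx.calls
  -- The root starts with depth `0` and no environment, so the relative budget is the bound itself;
  -- `h = log n + 1` levels suffice for ranges of up to `n + 1` elements.
  have hsafe := hrun 0 ((400 + 192 * (Nat.log 2 n + 1) : ℕ) : ℝ) (by simp)
  rw [← hx.tree, hx.partialSum_degreeAt] at hsafe
  refine ⟨PSAM.Safe.terminates (fun _ => rfl) hsafe, fun y hy => ?_⟩
  obtain ⟨k, hk, hwork⟩ := PSAM.Safe.reachable (fun _ => rfl) hsafe hy
  refine ⟨?_, ?_, ?_⟩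
  · have h1 : ∑ u ∈ U, G.degree u ≤ ∑ u ∈ U, max 1 (G.degree u) :=
      Finset.sum_le_sum fun _ _ => le_max_right _ _
    have h2 : U.card ≤ ∑ u ∈ U, max 1 (G.degree u) := by
      rw [Finset.card_eq_sum_ones]
      exact Finset.sum_le_sum fun _ _ => le_max_left _ _
    have h3 : 360 * ∑ u ∈ U, G.degree u + 229 * U.card + 400 ≤
        1000 * (1 + ∑ u ∈ U, max 1 (G.degree u)) := by omega
    have h4 : ((360 * ∑ u ∈ U, G.degree u + 229 * U.card + 400 : ℕ) : ℝ) ≤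
        ((1000 * (1 + ∑ u ∈ U, max 1 (G.degree u)) : ℕ) : ℝ) := Nat.cast_le.2 h3
    rw [hx.work, zero_add] at hwork
    have h5 : (0 : ℝ) ≤ k := k.cast_nonneg
    push_cast at h4 hwork ⊢
    linarith
  · refine (hk.depth_le fun _ => rfl).trans ?_
    exact_mod_cast (show 400 + 192 * (Nat.log 2 n + 1) ≤ 1000 * (Nat.log 2 n + 1) by omega)
  · rintro ⟨t, ht⟩
    rw [ht] at hk
    exact PSAM.EdgeMapResult.isEdgeMapOutput hx hcap ht (hk.ended fun _ => rfl)
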